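/- Let $q$ be a prime power and let $s$ be an odd prime with $s \ge q$ and $s \nmid q^2+1$. Let $G$ be an abelian group of order $(q^s+1)(q^{2s}+1)$. For a finite abelian group $A$, a subset $D\subseteq A$ is a $(v,k,\lambda)$ difference set in $A$ if $|A|=v$, $|D|=k\ge 1$ and, in the integral group ring $\mathbb{Z}A$, $$\Big(\sum_{d\in D} d\Big)\Big(\sum_{d\in D} d^{-1}\Big)=\lambda\sum_{g\in A} g+(k-\lambda)\,1 .$$ It is normalized if $\prod_{d\in D} d=1$. It has classical parameters (with $d=4$) for a prime power $Q$ if $$(v,k,\lambda)=\left(\frac{Q^4-1}{Q-1},\frac{Q^3-1}{Q-1},\frac{Q^2-1}{Q-1}\right)=\big((Q+1)(Q^2+1),\,Q^2+Q+1,\,Q+1\big).$$ Let $D$ be a normalized difference set in $G$ with classical parameters for $Q=q^s$, and let $M$ be a subgroup of $G$ of order $(q+1)(q^2+1)$. Then $D\cap M$ is a normalized difference set in $M$ with classical parameters for $Q=q$, i.e. a normalized $\big((q+1)(q^2+1),\,q^2+q+1,\,q+1\big)$ difference set in $M$. -/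

import Mathlib

/-- The element `∑_{g ∈ S} g` of the integral group ring `ℤG` attached to a subset `S` of `G`. -/
noncomputable def groupRingSum {G : Type*} [Group G] (S : Set G) : MonoidAlgebra ℤ G :=
  ∑ᶠ g ∈ S, MonoidAlgebra.single g (1 : ℤ)

/-- For `a = ∑ a_g g` in `ℤG`, the element `a^(-1) = ∑ a_g g⁻¹`. -/
noncomputable def groupRingInv {G : Type*} [Group G] (a : MonoidAlgebra ℤ G) :
    MonoidAlgebra ℤ G :=
  MonoidAlgebra.mapDomain (fun g : G => g⁻¹) a

/-- `D` is a `(v, k, l)`-difference set in the finite group `G`: `G` has order `v`, `D` is a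
`k`-subset with `k ≥ 1`, and `D D^(-1) = l G + (k - l) 1` in the integral group ring. -/
structure IsDifferenceSet {G : Type*} [Group G] [Finite G] (v k l : ℕ) (D : Set G) : Prop where
  card_group : Nat.card G = v
  card_set : D.ncard = k
  one_le : 1 ≤ k
  mul_inv_eq : groupRingSum D * groupRingInv (groupRingSum D) =
    (l : ℤ) • groupRingSum (Set.univ : Set G) + ((k : ℤ) - (l : ℤ)) • (1 : MonoidAlgebra ℤ G)

/-- `D` is a difference set with classical parameters
`((Q^d - 1)/(Q - 1), (Q^(d-1) - 1)/(Q - 1), (Q^(d-2) - 1)/(Q - 1))`, where `Q` is a prime power.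
Since `Q ≥ 2` and `d ≥ 2`, all the subtractions and divisions of natural numbers are exact. -/
structure IsClassicalDifferenceSet {G : Type*} [Group G] [Finite G] (Q d : ℕ) (D : Set G) :
    Prop where
  isPrimePow : IsPrimePow Q
  two_le : 2 ≤ d
  isDifferenceSet : IsDifferenceSet ((Q ^ d - 1) / (Q - 1)) ((Q ^ (d - 1) - 1) / (Q - 1))
    ((Q ^ (d - 2) - 1) / (Q - 1)) D

/-- A subset of a finite abelian group is normalized if the product of its elements is `1`. -/
def IsNormalizedSet {G : Type*} [CommGroup G] [Finite G] (D : Set G) : Prop :=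
  ∏ᶠ d ∈ D, d = 1

/-! Write `Q = q ^ s`, with `q` a power of the prime `p`. The order of `D` is `Q ^ 2`, a power of
`p` exceeding `λ = Q + 1`, so a multiplier theorem applies. Normalization then makes `D` itself
stable under `x ↦ x ^ p` (`IsDifferenceSet.pow_mem`).

Let `U` be a subgroup of order `Q + 1`. On `G ⧸ U`, of order `Q ^ 2 + 1`, the multiplier `Q ^ 2` is
inversion, so the image `X` of `D` is symmetric and `(X - W) ^ 2 = Q ^ 2`, where `W` is the sum of
all elements. The group ring mod `p` is reduced, hence `X = W + Q b` for one element `b`: `D`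
contains one coset `cU` and meets every other coset once (`IsDifferenceSet.exists_coset_subset`).

Let `F` be the group of fixed points of `x ↦ x ^ q ^ 4`; it contains `M`. The set `D ∩ F` inherits
this shape relative to `V = U ∩ F`. The map has `s`-th iterate the identity, so orbit counting gives
each `g ∈ F` outside `V` a number of representations as a quotient in `D ∩ F` congruent to `Q + 1 ≡
q + 1` mod `s`. There are at least two, and `s ≥ q`, so there are at least `q + 1`. Since `V` has
index dividing `q ^ 2 + 1` in `F`, which is where `s ∤ q ^ 2 + 1` enters, double counting forces
equality everywhere (`isDifferenceSet_of_coset_structure`), and `F = M`.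

For normalization, the elements of `D` outside `M` multiply to `1`: those off `cU` fall into orbits
of length four under `x ↦ x ^ Q`, and those in `cU` are handled by inversion on `U`
(`isNormalizedSet_inter`). -/

/-! ### Divisibility by prime powers and lifts of Frobenius -/

section FrobeniusLift

variable {R : Type*} [CommRing R] {p : ℕ}

/-- If `p` is a nonzerodivisor and `R / p` is reduced, then divisibility of squares by `p ^ (2 * a)`
descends. -/
theorem pow_dvd_of_pow_dvd_sq (hp : ∀ x : R, (p : R) * x = 0 → x = 0)
    (hred : ∀ x : R, (p : R) ∣ x ^ 2 → (p : R) ∣ x) (a : ℕ) :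
    ∀ x : R, (p : R) ^ (2 * a) ∣ x ^ 2 → (p : R) ^ a ∣ x := by
  have hpow : ∀ (k : ℕ) (x : R), (p : R) ^ k * x = 0 → x = 0 := by
    intro k
    induction k with
    | zero => intro x hx; simpa using hx
    | succ k ih => intro x hx; exact hp x (ih _ (by rw [← hx]; ring))
  induction a with
  | zero => intro x _; simp
  | succ a ih =>
    intro x hx
    obtain ⟨z, rfl⟩ := ih x ((pow_dvd_pow _ (by omega)).trans hx)
    obtain ⟨w, hw⟩ := hx
    have h : z ^ 2 = (p : R) * (p * w) := by
      rw [← sub_eq_zero]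
      apply hpow (2 * a)
      have : (p : R) ^ (2 * a) * (z ^ 2 - p * (p * w)) =
        (p ^ a * z) ^ 2 - p ^ (2 * (a + 1)) * w := by ring
      rw [this, hw, sub_self]
    obtain ⟨u, rfl⟩ := hred z ⟨_, h⟩
    exact ⟨u, by ring⟩

/-- Let `φ` lift the Frobenius of `R / p`, where every element of `R / p` satisfies
`x ^ (N + 1) = x`. Then `p ^ a ∣ x * y` implies `p ^ a ∣ φ x * y`. -/
theorem pow_dvd_map_mul_of_pow_dvd_mul (hp : ∀ x : R, (p : R) * x = 0 → x = 0) (φ : R →+* R)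
    (hφ : ∀ x : R, (p : R) ∣ φ x - x ^ p) {N : ℕ} (hN : 0 < N)
    (hperf : ∀ x : R, (p : R) ∣ x ^ (N + 1) - x) (hp0 : 0 < p) (a : ℕ) :
    ∀ x y : R, (p : R) ^ a ∣ x * y → (p : R) ^ a ∣ φ x * y := by
  induction a with
  | zero => intro x y _; simp
  | succ a ih =>
    intro x y hxy
    have hmul : ∀ k, 0 < k → (p : R) ^ (a + 1) ∣ x ^ k * y := by
      rintro (_ | k) hk
      · omega
      · have : x ^ (k + 1) * y = x ^ k * (x * y) := by ring
        exact this ▸ hxy.mul_left _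
    have hE : ∀ k : ℕ, (p : R) ∣ x ^ (N * k) * x - x := by
      intro k
      induction k with
      | zero => simp
      | succ k ihk =>
        have : x ^ (N * (k + 1)) * x - x =
          x ^ (N * k) * (x ^ (N + 1) - x) + (x ^ (N * k) * x - x) := by ring
        exact this ▸ dvd_add ((hperf x).mul_left _) ihk
    -- `E` is a multiple of `x` with `E * x ≡ x` mod `p`. The exponent `p ^ a` lifts the congruence
    -- `φ x ^ N ≡ (x ^ p) ^ N` from mod `p` to mod `p ^ (a + 1)`.
    set E := x ^ (N * p ^ a) with hEdef
    have hEy : (p : R) ^ (a + 1) ∣ E * y := hmul _ (by positivity)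
    have hφE : (p : R) ^ (a + 1) ∣ φ E * y := by
      have h1 : (p : R) ∣ φ x ^ N - (x ^ p) ^ N := (hφ x).trans (sub_dvd_pow_sub_pow _ _ N)
      have h2 := dvd_sub_pow_of_dvd_sub h1 a
      have h3 : φ E * y =
          ((φ x ^ N) ^ p ^ a - ((x ^ p) ^ N) ^ p ^ a) * y + x ^ (p * N * p ^ a) * y := by
        rw [hEdef, map_pow]; ring
      rw [h3]
      exact dvd_add (h2.mul_right _) (hmul _ (by positivity))
    obtain ⟨z, hz⟩ := hE (p ^ a)
    have hzy : (p : R) ^ a ∣ z * y := by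
      obtain ⟨w, hw⟩ : (p : R) ^ (a + 1) ∣ p * (z * y) := by
        have : (p : R) * (z * y) = x * (E * y) - x * y := by
          rw [← mul_assoc, ← hz]; ring
        exact this ▸ dvd_sub (hEy.mul_left _) hxy
      refine ⟨w, ?_⟩
      rw [← sub_eq_zero]
      apply hp
      rw [mul_sub, hw]; ring
    have key : φ x * y = φ x * (φ E * y) - p * (φ z * y) := by
      have := congrArg φ hz
      simp only [map_sub, map_mul, map_natCast] at this
      rw [← mul_assoc (p : R), ← this]; ring
    rw [key, pow_succ']
    exact dvd_sub ((pow_succ' (p : R) a ▸ hφE).mul_left _) (mul_dvd_mul_left _ (ih z y hzy))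

end FrobeniusLift

/-! ### The integral group ring and difference counts -/

section GroupRing
open MonoidAlgebra
variable {G : Type*} [CommGroup G]

theorem coeff_natCast_mul (n : ℕ) (x : MonoidAlgebra ℤ G) (g : G) :
    ((n : MonoidAlgebra ℤ G) * x).coeff g = n * x.coeff g := by
  rw [natCast_def, coeff_single_one_mul]

theorem dvd_coeff_of_natCast_dvd {n : ℕ} {x : MonoidAlgebra ℤ G}
    (h : (n : MonoidAlgebra ℤ G) ∣ x) (g : G) : (n : ℤ) ∣ x.coeff g := by
  obtain ⟨y, rfl⟩ := h
  exact ⟨y.coeff g, coeff_natCast_mul n y g⟩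

theorem natCast_mul_eq_zero {n : ℕ} (hn : n ≠ 0) (x : MonoidAlgebra ℤ G)
    (h : (n : MonoidAlgebra ℤ G) * x = 0) : x = 0 := by
  ext g
  have := congrArg (fun y : MonoidAlgebra ℤ G => y.coeff g) h
  simpa [hn, coeff_natCast_mul] using this

/-- The ring endomorphism of the group ring induced by `g ↦ g ^ n`. -/
noncomputable def powMap (n : ℕ) : MonoidAlgebra ℤ G →+* MonoidAlgebra ℤ G :=
  mapDomainRingHom ℤ (powMonoidHom n)

@[simp] theorem powMap_single (n : ℕ) (g : G) (r : ℤ) :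
    powMap n (single g r) = single (g ^ n) r := by
  simp [powMap]

theorem powMap_powMap (m n : ℕ) (x : MonoidAlgebra ℤ G) :
    powMap m (powMap n x) = powMap (n * m) x := by
  induction x using MonoidAlgebra.induction_linear with
  | zero => simp
  | add x y hx hy => simp [hx, hy]
  | single g r => simp [pow_mul]

theorem powMap_eq_self {n : ℕ} (h : ∀ g : G, g ^ n = g) (x : MonoidAlgebra ℤ G) :
    powMap n x = x := by
  induction x using MonoidAlgebra.induction_linear with
  | zero => simp
  | add x y hx hy => simp [hx, hy]
  | single g r => simp [h]

theorem dvd_powMap_sub_pow {p : ℕ} (hp : p.Prime) (x : MonoidAlgebra ℤ G) :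
    (p : MonoidAlgebra ℤ G) ∣ powMap p x - x ^ p := by
  induction x using MonoidAlgebra.induction_linear with
  | zero => simp [hp.ne_zero]
  | add x y hx hy =>
    obtain ⟨r, hr⟩ := exists_add_pow_prime_eq hp x y
    rw [hr, map_add]
    have : powMap p x + powMap p y - (x ^ p + y ^ p + p * x * y * r) =
      (powMap p x - x ^ p) + (powMap p y - y ^ p) - p * (x * y * r) := by ring
    rw [this]
    exact dvd_sub (dvd_add hx hy) (dvd_mul_right _ _)
  | single g r =>
    have : Fact p.Prime := ⟨hp⟩
    obtain ⟨k, hk⟩ : (p : ℤ) ∣ r - r ^ p := by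
      rw [← ZMod.intCast_zmod_eq_zero_iff_dvd]
      push_cast
      rw [ZMod.pow_card, sub_self]
    refine ⟨single (g ^ p) k, ?_⟩
    rw [powMap_single, single_pow, ← single_sub, hk, natCast_def, single_mul_single]
    simp

theorem dvd_powMap_pow_sub_pow {p : ℕ} (hp : p.Prime) (x : MonoidAlgebra ℤ G) (m : ℕ) :
    (p : MonoidAlgebra ℤ G) ∣ powMap (p ^ m) x - x ^ p ^ m := by
  induction m with
  | zero => simp [powMap_eq_self]
  | succ m ih =>
    have h1 := dvd_powMap_sub_pow hp (powMap (p ^ m) x)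
    have h2 := ih.trans (sub_dvd_pow_sub_pow _ _ p)
    rw [powMap_powMap, ← pow_succ] at h1
    rw [← pow_mul, ← pow_succ] at h2
    simpa using dvd_add h1 h2

theorem dvd_pow_sub_self {p m : ℕ} (hp : p.Prime) (hG : ∀ g : G, g ^ p ^ m = g)
    (x : MonoidAlgebra ℤ G) : (p : MonoidAlgebra ℤ G) ∣ x ^ p ^ m - x := by
  have := dvd_powMap_pow_sub_pow hp x m
  rwa [powMap_eq_self hG, dvd_sub_comm] at this

/-- The augmentation of the integral group ring. -/
noncomputable def augmentation : MonoidAlgebra ℤ G →+* ℤ :=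
  (MonoidAlgebra.lift ℤ ℤ G 1 : MonoidAlgebra ℤ G →ₐ[ℤ] ℤ)

@[simp] theorem augmentation_single (g : G) (r : ℤ) : augmentation (single g r) = r := by
  simp [augmentation]

theorem groupRingInv_single (g : G) (r : ℤ) : groupRingInv (single g r) = single g⁻¹ r := by
  simp [groupRingInv]

@[simp] theorem groupRingInv_zero : groupRingInv (0 : MonoidAlgebra ℤ G) = 0 := by
  simp [groupRingInv]

theorem groupRingInv_add (x y : MonoidAlgebra ℤ G) :
    groupRingInv (x + y) = groupRingInv x + groupRingInv y := by
  simp [groupRingInv, mapDomain_add]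

theorem coeff_groupRingInv (x : MonoidAlgebra ℤ G) (g : G) :
    (groupRingInv x).coeff g = x.coeff g⁻¹ := by
  classical
  induction x using MonoidAlgebra.induction_linear with
  | zero => simp
  | add x y hx hy => simp [groupRingInv_add, hx, hy]
  | single h r =>
    rw [groupRingInv_single]
    simp [Finsupp.single_apply, inv_eq_iff_eq_inv]

@[simp] theorem augmentation_groupRingInv (x : MonoidAlgebra ℤ G) :
    augmentation (groupRingInv x) = augmentation x := by
  induction x using MonoidAlgebra.induction_linear with
  | zero => simp
  | add x y hx hy => simp [groupRingInv_add, hx, hy]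
  | single h r => simp [groupRingInv_single]

theorem coeff_mul_groupRingInv [Fintype G] (x y : MonoidAlgebra ℤ G) (g : G) :
    (x * groupRingInv y).coeff g = ∑ b, x.coeff (g * b) * y.coeff b := by
  induction y using MonoidAlgebra.induction_linear with
  | zero => simp
  | add y z hy hz => simp [groupRingInv_add, mul_add, hy, hz, Finset.sum_add_distrib]
  | single h r =>
    classical
    simp [groupRingInv_single, Finsupp.single_apply]

theorem augmentation_eq_sum [Fintype G] (x : MonoidAlgebra ℤ G) :
    augmentation x = ∑ g, x.coeff g := by
  classical
  induction x using MonoidAlgebra.induction_linear with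
  | zero => simp
  | add x y hx hy => simp [hx, hy, Finset.sum_add_distrib]
  | single g r => simp [Finsupp.single_apply]

variable [Finite G]

theorem groupRingSum_eq_sum [Fintype G] (S : Set G) [DecidablePred (· ∈ S)] :
    groupRingSum S = ∑ g : G with g ∈ S, single g (1 : ℤ) := by
  rw [groupRingSum, finsum_mem_eq_finite_toFinset_sum _ (Set.toFinite S)]
  congr 1
  ext; simp

open Classical in
theorem coeff_groupRingSum (S : Set G) (g : G) :
    (groupRingSum S).coeff g = if g ∈ S then 1 else 0 := by
  have := Fintype.ofFinite G
  rw [groupRingSum_eq_sum, coeff_sum, Finsupp.finsetSum_apply]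
  simp [Finsupp.single_apply]

@[simp] theorem augmentation_groupRingSum (S : Set G) :
    augmentation (groupRingSum S) = S.ncard := by
  classical
  have := Fintype.ofFinite G
  rw [groupRingSum_eq_sum, map_sum]
  simp [Set.ncard_eq_toFinset_card']

theorem mul_groupRingSum_univ (x : MonoidAlgebra ℤ G) :
    x * groupRingSum Set.univ = (augmentation x : MonoidAlgebra ℤ G) * groupRingSum Set.univ := by
  induction x using MonoidAlgebra.induction_linear with
  | zero => simp
  | add x y hx hy => simp [hx, hy, add_mul]
  | single g r =>
    ext h
    rw [coeff_single_mul_apply, augmentation_single, intCast_def, coeff_single_mul_apply]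
    simp [coeff_groupRingSum]

theorem coeff_groupRingSum_mul_inv (S T : Set G) (g : G) :
    (groupRingSum S * groupRingInv (groupRingSum T)).coeff g = {b ∈ T | g * b ∈ S}.ncard := by
  classical
  have := Fintype.ofFinite G
  rw [coeff_mul_groupRingInv, Set.ncard_eq_toFinset_card']
  simp only [coeff_groupRingSum, ← ite_and, mul_ite, mul_one, mul_zero, Finset.sum_boole,
    Set.toFinset_ofPred]

open Classical in
theorem isDifferenceSet_iff {v k l : ℕ} {D : Set G} : IsDifferenceSet v k l D ↔
    Nat.card G = v ∧ D.ncard = k ∧ 1 ≤ k ∧ ∀ g ≠ 1, {b ∈ D | g * b ∈ D}.ncard = l := by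
  have key : ∀ g : G, ((l : ℤ) • groupRingSum (Set.univ : Set G) + ((k : ℤ) - (l : ℤ)) •
      (1 : MonoidAlgebra ℤ G)).coeff g = if g = 1 then (k : ℤ) else l := by
    intro g
    simp only [coeff_add, coeff_smul, Finsupp.add_apply, Finsupp.smul_apply, coeff_groupRingSum,
      one_def, coeff_single, Finsupp.single_apply]
    by_cases h : g = 1
    · simp [h]
    · simp [h, Ne.symm h]
  constructor
  · rintro ⟨h1, h2, h3, h4⟩
    refine ⟨h1, h2, h3, fun g hg => ?_⟩
    have := congrArg (fun y : MonoidAlgebra ℤ G => y.coeff g) h4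
    simp only [key, if_neg hg, coeff_groupRingSum_mul_inv] at this
    exact_mod_cast this
  · rintro ⟨h1, h2, h3, h4⟩
    refine ⟨h1, h2, h3, ?_⟩
    ext g
    rw [key, coeff_groupRingSum_mul_inv]
    split_ifs with h
    · simp [h, h2]
    · rw [h4 g h]

end GroupRing

/-! ### The multiplier theorem -/

section Multiplier
open MonoidAlgebra
variable {G : Type*} [CommGroup G]

/-- Integrality leaves one nonzero value, `±1`, and the sum fixes its sign. This isolates both the
translate in the multiplier theorem and the exceptional coset. -/
theorem exists_eq_single_of_sum_sq_eq_one {ι : Type*} [Fintype ι] [DecidableEq ι] (f : ι → ℤ)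
    (h1 : ∑ i, f i = 1) (h2 : ∑ i, f i ^ 2 = 1) : ∃ c, ∀ i, f i = if i = c then 1 else 0 := by
  obtain ⟨c, hc⟩ : ∃ c, f c ≠ 0 := by
    by_contra! h
    simp [h] at h1
  have h3 := Finset.add_sum_erase Finset.univ (fun i => f i ^ 2) (Finset.mem_univ c)
  simp only [h2] at h3
  have h4 : 1 ≤ f c ^ 2 := by have := sq_pos_of_ne_zero hc; omega
  have h5 : 0 ≤ ∑ i ∈ Finset.univ.erase c, f i ^ 2 := Finset.sum_nonneg fun _ _ => sq_nonneg _
  have h6 : ∀ i, i ≠ c → f i = 0 := by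
    intro i hi
    have := (Finset.sum_eq_zero_iff_of_nonneg (fun i _ => sq_nonneg (f i))).1
      (show ∑ i ∈ Finset.univ.erase c, f i ^ 2 = 0 by omega) i (by simp [hi])
    simpa using this
  refine ⟨c, fun i => ?_⟩
  split_ifs with hi
  · rw [hi, ← h1, Finset.sum_eq_single c (fun i _ hi => h6 i hi) (by simp)]
  · exact h6 i hi

theorem pow_injective_of_pow_pow_eq {p m : ℕ} (hm : 0 < m) (hG : ∀ g : G, g ^ p ^ m = g) :
    Function.Injective fun g : G => g ^ p := by
  intro x y hxy
  obtain ⟨m, rfl⟩ : ∃ k, m = k + 1 := ⟨m - 1, by omega⟩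
  simp only at hxy
  rw [← hG x, ← hG y, pow_succ', pow_mul, pow_mul, hxy]

/-- `powMap p` lifts Frobenius, and `hG` gives `x ^ p ^ m ≡ x` mod `p`. Keeping the full power `p ^
a` lets the multiplier theorem assume `l < p ^ a` rather than `l < p`. -/
theorem pow_dvd_powMap_mul {p m a : ℕ} (hp : p.Prime) (hm : 0 < m) (hG : ∀ g : G, g ^ p ^ m = g)
    {x y : MonoidAlgebra ℤ G} (h : (p : MonoidAlgebra ℤ G) ^ a ∣ x * y) :
    (p : MonoidAlgebra ℤ G) ^ a ∣ powMap p x * y := by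
  have h1 : 1 < p ^ m := Nat.one_lt_pow hm.ne' hp.one_lt
  have hperf : ∀ x : MonoidAlgebra ℤ G, (p : MonoidAlgebra ℤ G) ∣ x ^ (p ^ m - 1 + 1) - x := by
    rw [Nat.sub_add_cancel h1.le]
    exact dvd_pow_sub_self hp hG
  exact pow_dvd_map_mul_of_pow_dvd_mul (R := MonoidAlgebra ℤ G) (p := p)
    (natCast_mul_eq_zero hp.ne_zero) (powMap p) (dvd_powMap_sub_pow hp) (N := p ^ m - 1)
    (Nat.sub_pos_of_lt h1) hperf hp.pos a x y h

/-- Reducedness mod `p`: if `p` divides `y ^ 2`, it divides `y ^ p ^ m`, which is congruent to `y`.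
-/
theorem groupRing_pow_dvd_of_pow_dvd_sq {p m a : ℕ} (hp : p.Prime) (hm : 0 < m)
    (hG : ∀ g : G, g ^ p ^ m = g) {x : MonoidAlgebra ℤ G}
    (h : (p : MonoidAlgebra ℤ G) ^ (2 * a) ∣ x ^ 2) : (p : MonoidAlgebra ℤ G) ^ a ∣ x := by
  refine pow_dvd_of_pow_dvd_sq (R := MonoidAlgebra ℤ G) (p := p)
    (natCast_mul_eq_zero hp.ne_zero) (fun y hy => ?_) a x h
  have h1 : 1 < p ^ m := Nat.one_lt_pow hm.ne' hp.one_lt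
  have h2 := hy.trans (pow_dvd_pow y h1)
  exact (dvd_sub_right h2).1 (dvd_pow_sub_self hp hG y)

variable [Finite G]

theorem powMap_groupRingSum {n : ℕ} (hn : Function.Injective fun g : G => g ^ n) (S : Set G) :
    powMap n (groupRingSum S) = groupRingSum ((fun g => g ^ n) '' S) := by
  rw [groupRingSum, groupRingSum, finsum_mem_image hn.injOn]
  have := AddMonoidHom.map_finsum_mem (fun g : G => (single g (1 : ℤ) : MonoidAlgebra ℤ G))
    (powMap n : MonoidAlgebra ℤ G →+* MonoidAlgebra ℤ G).toAddMonoidHom (Set.toFinite S)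
  simpa using this

theorem IsDifferenceSet.sq_eq {v k l : ℕ} {D : Set G} (hD : IsDifferenceSet v k l D) :
    (k : ℤ) ^ 2 = l * v + (k - l) := by
  have h := congrArg augmentation hD.mul_inv_eq
  simp only [map_mul, augmentation_groupRingInv, augmentation_groupRingSum, hD.card_set, map_add,
    zsmul_eq_mul, map_intCast, map_one, Set.ncard_univ, hD.card_group] at h
  rw [sq, h]
  simp

/-- The multiplier theorem for difference sets whose order `k - l` is a power of a prime `p`. -/
theorem IsDifferenceSet.exists_groupRingSum_image_pow {v k l p a m : ℕ} {D : Set G}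
    (hD : IsDifferenceSet v k l D) (hp : p.Prime) (hk : k = l + p ^ a) (hl : l < p ^ a)
    (hm : 0 < m) (hG : ∀ g : G, g ^ p ^ m = g) :
    ∃ c : G, groupRingSum ((fun g => g ^ p) '' D) = single c 1 * groupRingSum D := by
  classical
  have := Fintype.ofFinite G
  set D' := (fun g : G => g ^ p) '' D
  set S := groupRingSum D with hS
  set W := groupRingSum (Set.univ : Set G)
  have hinj := pow_injective_of_pow_pow_eq hm hG
  have hD' : powMap p S = groupRingSum D' := powMap_groupRingSum hinj D
  have hSS : S * groupRingInv S = (l : MonoidAlgebra ℤ G) * W + p ^ a := by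
    have := hD.mul_inv_eq
    rw [this, zsmul_eq_mul, zsmul_eq_mul, hk]
    push_cast; ring
  have hSW : S * W = k * W := by
    rw [mul_groupRingSum_univ, augmentation_groupRingSum, hD.card_set]; simp [W]
  have hD'W : groupRingSum D' * W = k * W := by
    rw [mul_groupRingSum_univ, augmentation_groupRingSum,
      Set.ncard_image_of_injective _ hinj, hD.card_set]; simp [W]
  -- Subtracting `W` makes the product divisible: `S * (groupRingInv S - W) = p ^ a * (1 - W)`,
  -- whereas `S * groupRingInv S` retains `l * W`.
  have hdvd : (p : MonoidAlgebra ℤ G) ^ a ∣ groupRingSum D' * (groupRingInv S - W) := by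
    rw [← hD']
    have haux : ∀ L P : MonoidAlgebra ℤ G, L * W + P - (L + P) * W = P * (1 - W) := by
      intro L P; ring
    apply pow_dvd_powMap_mul hp hm hG
    rw [mul_sub, hSS, hSW, hk, Nat.cast_add, Nat.cast_pow, haux]
    exact dvd_mul_right _ _
  have hcoeff : ∀ g, ((p ^ a : ℕ) : ℤ) ∣ (groupRingSum D' * groupRingInv S).coeff g - l := by
    intro g
    rw [mul_sub, hD'W, ← Nat.cast_pow] at hdvd
    have := dvd_coeff_of_natCast_dvd hdvd g
    rw [coeff_sub, Finsupp.sub_apply, coeff_natCast_mul, coeff_groupRingSum,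
      if_pos (Set.mem_univ g), hk] at this
    have h2 := dvd_add this (dvd_refl ((p ^ a : ℕ) : ℤ))
    rwa [mul_one, Nat.cast_add, sub_add, add_sub_cancel_right] at h2
  have hnonneg : ∀ g, 0 ≤ (groupRingSum D' * groupRingInv S).coeff g := by
    intro g
    rw [coeff_groupRingSum_mul_inv]
    positivity
  have hsum : ∑ g, (groupRingSum D' * groupRingInv S).coeff g = (k : ℤ) ^ 2 := by
    rw [← augmentation_eq_sum, map_mul, augmentation_groupRingInv, augmentation_groupRingSum,
      augmentation_groupRingSum, Set.ncard_image_of_injective _ hinj, hD.card_set, sq]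
  choose B hB using hcoeff
  have hpa : (0 : ℤ) < (p ^ a : ℕ) := by exact_mod_cast pow_pos hp.pos a
  -- The coefficients are `l + p ^ a * B g`; as `l < p ^ a`, a negative `B g` would give a negative
  -- count.
  have hBnonneg : ∀ g, 0 ≤ B g := by
    intro g
    by_contra! h
    have h1 := hnonneg g
    have h2 := hB g
    have h3 : ((p ^ a : ℕ) : ℤ) * B g ≤ (p ^ a : ℕ) * (-1) :=
      mul_le_mul_of_nonneg_left (by omega) hpa.le
    have h4 : (l : ℤ) < (p ^ a : ℕ) := by exact_mod_cast hl
    omega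
  have hBsum : ∑ g, B g = 1 := by
    have h1 : ∑ g, ((groupRingSum D' * groupRingInv S).coeff g - l) =
        ((p ^ a : ℕ) : ℤ) * ∑ g, B g := by
      rw [Finset.mul_sum]; exact Finset.sum_congr rfl fun g _ => hB g
    rw [Finset.sum_sub_distrib, hsum, hD.sq_eq, Finset.sum_const, Finset.card_univ,
      ← Nat.card_eq_fintype_card, hD.card_group, hk] at h1
    apply mul_left_cancel₀ hpa.ne'
    rw [← h1]
    push_cast
    rw [nsmul_eq_mul]; ring
  obtain ⟨c, hc⟩ : ∃ c, ∀ g, B g = if g = c then 1 else 0 := by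
    refine exists_eq_single_of_sum_sq_eq_one B hBsum ?_
    have hle : ∀ g, B g ≤ 1 := fun g =>
      hBsum ▸ Finset.single_le_sum (fun i _ => hBnonneg i) (Finset.mem_univ g)
    rw [← hBsum]
    refine Finset.sum_congr rfl fun g _ => ?_
    have := hle g
    have := hBnonneg g
    obtain h | h : B g = 0 ∨ B g = 1 := by omega
    all_goals simp [h]
  have heq : groupRingSum D' * groupRingInv S =
      (l : MonoidAlgebra ℤ G) * W + ((p ^ a : ℕ) : MonoidAlgebra ℤ G) * single c 1 := by
    ext g
    have := hB g
    rw [coeff_add, Finsupp.add_apply, coeff_natCast_mul, coeff_natCast_mul, coeff_groupRingSum,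
      if_pos (Set.mem_univ g), coeff_single, Finsupp.single_apply]
    rw [hc] at this
    simp only [eq_comm (a := c)]
    linarith
  refine ⟨c, ?_⟩
  rw [← sub_eq_zero]
  apply natCast_mul_eq_zero (pow_ne_zero a hp.ne_zero)
  have h1 : groupRingSum D' * (S * groupRingInv S) =
      (l : MonoidAlgebra ℤ G) * (S * W) + ((p ^ a : ℕ) : MonoidAlgebra ℤ G) * (single c 1 * S) := by
    rw [mul_left_comm, heq]; ring
  rw [hSS, hSW, mul_add, mul_left_comm, hD'W] at h1
  rw [mul_sub, ← add_left_cancel h1]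
  push_cast; ring

theorem finprod_mem_mul_left (c : G) (S : Set G) :
    ∏ᶠ x ∈ S, c * x = c ^ S.ncard * ∏ᶠ x ∈ S, x := by
  rw [finprod_mem_mul_distrib (Set.toFinite S), finprod_mem_eq_finite_toFinset_prod _
    (Set.toFinite S), Finset.prod_const, Set.ncard_eq_toFinset_card]

/-- A normalized difference set whose order is a power of a prime `p` is fixed by the multiplier
`p`. -/
theorem IsDifferenceSet.pow_mem {v k l p a m : ℕ} {D : Set G}
    (hD : IsDifferenceSet v k l D) (hnorm : IsNormalizedSet D) (hp : p.Prime)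
    (hk : k = l + p ^ a) (hl : l < p ^ a) (hm : 0 < m) (hG : ∀ g : G, g ^ p ^ m = g)
    (hkG : ∀ g : G, g ^ k = 1 → g = 1) {x : G} (hx : x ∈ D) : x ^ p ∈ D := by
  classical
  obtain ⟨c, hc⟩ := hD.exists_groupRingSum_image_pow hp hk hl hm hG
  have himg : (fun g => g ^ p) '' D = (fun g => c * g) '' D := by
    ext g
    have := congrArg (fun y : MonoidAlgebra ℤ G => y.coeff g) hc
    simp only [coeff_single_mul_apply, coeff_groupRingSum, one_mul] at this
    rw [Set.image_mul_left, Set.mem_preimage]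
    by_cases h1 : c⁻¹ * g ∈ D <;> by_cases h2 : g ∈ (fun g => g ^ p) '' D <;>
      simp only [h1, h2, if_true, if_false] at this ⊢ <;> omega
  -- Comparing the products over `D ^ p = c D` gives `c ^ k = 1`, hence `c = 1`.
  have h1 : ∏ᶠ x ∈ (fun g => g ^ p) '' D, x = 1 := by
    rw [finprod_mem_image (pow_injective_of_pow_pow_eq hm hG).injOn]
    have := (powMonoidHom p : G →* G).map_finprod_mem id (Set.toFinite D)
    simp only [powMonoidHom_apply, id] at this
    rw [← this, hnorm, one_pow]
  rw [himg, finprod_mem_image (mul_right_injective c).injOn, finprod_mem_mul_left, hnorm,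
    hD.card_set, mul_one] at h1
  rw [hkG c h1] at himg
  have := Set.mem_image_of_mem (fun g => g ^ p) hx
  rw [himg] at this
  simpa using this

end Multiplier

/-! ### Intersections of the difference set with cosets -/

section CosetStructure
open MonoidAlgebra
variable {G : Type*} [CommGroup G] {H : Type*} [CommGroup H]

theorem mapDomainRingHom_powMap (f : G →* H) (n : ℕ) (x : MonoidAlgebra ℤ G) :
    mapDomainRingHom ℤ f (powMap n x) = powMap n (mapDomainRingHom ℤ f x) := by
  induction x using MonoidAlgebra.induction_linear with
  | zero => simp
  | add x y hx hy => rw [map_add, map_add, map_add, map_add, hx, hy]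
  | single g r => rw [powMap_single]; simp

theorem mapDomainRingHom_groupRingInv (f : G →* H) (x : MonoidAlgebra ℤ G) :
    mapDomainRingHom ℤ f (groupRingInv x) = groupRingInv (mapDomainRingHom ℤ f x) := by
  induction x using MonoidAlgebra.induction_linear with
  | zero => simp
  | add x y hx hy => rw [groupRingInv_add, map_add, map_add, groupRingInv_add, hx, hy]
  | single g r => rw [groupRingInv_single]; simp [groupRingInv_single]

theorem augmentation_mapDomainRingHom (f : G →* H) (x : MonoidAlgebra ℤ G) :
    augmentation (mapDomainRingHom ℤ f x) = augmentation x := by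
  induction x using MonoidAlgebra.induction_linear with
  | zero => simp
  | add x y hx hy => rw [map_add, map_add, map_add, hx, hy]
  | single g r => simp

theorem powMap_eq_groupRingInv {n : ℕ} (h : ∀ g : G, g ^ n = g⁻¹) (x : MonoidAlgebra ℤ G) :
    powMap n x = groupRingInv x := by
  induction x using MonoidAlgebra.induction_linear with
  | zero => simp
  | add x y hx hy => rw [map_add, groupRingInv_add, hx, hy]
  | single g r => rw [powMap_single, groupRingInv_single, h]

theorem ncard_fiber_mk (U : Subgroup G) (h : G ⧸ U) :
    {x ∈ (Set.univ : Set G) | QuotientGroup.mk' U x = h}.ncard = Nat.card U := by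
  obtain ⟨g, rfl⟩ := QuotientGroup.mk'_surjective U h
  have : {x ∈ (Set.univ : Set G) | QuotientGroup.mk' U x = QuotientGroup.mk' U g} =
      (fun u => g * u) '' (U : Set G) := by
    ext x
    rw [Set.image_mul_left]
    simp [eq_comm (b := (g : G ⧸ U)), QuotientGroup.eq]
  rw [this, Set.ncard_image_of_injective _ (mul_right_injective g)]
  rfl

variable [Finite G]

theorem coeff_mapDomainRingHom_groupRingSum (f : G →* H) (S : Set G) (h : H) :
    (mapDomainRingHom ℤ f (groupRingSum S)).coeff h = {x ∈ S | f x = h}.ncard := by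
  classical
  have := Fintype.ofFinite G
  rw [groupRingSum_eq_sum, map_sum, coeff_sum, Finsupp.finsetSum_apply,
    Set.ncard_eq_toFinset_card']
  simp [Finsupp.single_apply, Finset.filter_filter, Set.toFinset_ofPred]

/-- A difference set with classical parameters for `Q = p ^ e` and `d = 4` which is fixed by the
multiplier `Q ^ 2` contains a coset of any subgroup `U` of order `Q + 1`, and meets
every other coset in exactly one element. -/
theorem IsDifferenceSet.exists_coset_subset {v p e : ℕ} {D : Set G}
    (hD : IsDifferenceSet v ((p ^ e) ^ 2 + p ^ e + 1) (p ^ e + 1) D) (hp : p.Prime) (he : 0 < e)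
    (hv : v = (p ^ e + 1) * ((p ^ e) ^ 2 + 1))
    (hDQ : (fun g => g ^ (p ^ e) ^ 2) '' D = D) (U : Subgroup G) (hU : Nat.card U = p ^ e + 1) :
    ∃ c : G, c ^ 2 ∈ U ∧ (∀ u ∈ U, c * u ∈ D) ∧
      ∀ x, c⁻¹ * x ∉ U → ∃ d, {y ∈ D | x⁻¹ * y ∈ U} = {d} := by
  classical
  have := Fintype.ofFinite (G ⧸ U)
  obtain ⟨Q, hQ⟩ : ∃ Q, Q = p ^ e := ⟨_, rfl⟩
  have hQ0 : 0 < Q := hQ ▸ pow_pos hp.pos e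
  rw [← hQ] at hD hv hDQ hU
  have hcardH : Nat.card (G ⧸ U) = Q ^ 2 + 1 := by
    have := U.card_eq_card_quotient_mul_card_subgroup
    rw [hD.card_group, hU, hv, mul_comm] at this
    exact (Nat.eq_of_mul_eq_mul_right (by omega) this).symm
  have hinvH : ∀ h : G ⧸ U, h ^ Q ^ 2 = h⁻¹ := fun h => by
    rw [eq_inv_iff_mul_eq_one, ← pow_succ, ← hcardH, pow_card_eq_one']
  have hinvH' : ∀ h : G ⧸ U, h ^ p ^ (4 * e) = h := fun h => by
    have : p ^ (4 * e) = Q ^ 2 * Q ^ 2 := by rw [hQ]; ring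
    rw [this, pow_mul, hinvH, hinvH, inv_inv]
  have hinj : Function.Injective fun g : G => g ^ Q ^ 2 := by
    have hcop : (Nat.card G).Coprime (Q ^ 2) := by
      rw [hD.card_group, hv]
      refine Nat.Coprime.pow_right 2 (Nat.Coprime.mul_left ?_ ?_)
      · simp
      · rw [sq, Nat.coprime_mul_right_add_left]
        exact Nat.coprime_one_left Q
    exact hcop.pow_left_bijective.injective
  let f := mapDomainRingHom ℤ (QuotientGroup.mk' U)
  obtain ⟨X, hX⟩ : ∃ X, X = f (groupRingSum D) := ⟨_, rfl⟩
  obtain ⟨W, hW⟩ : ∃ W, W = groupRingSum (Set.univ : Set (G ⧸ U)) := ⟨_, rfl⟩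
  have hfW : f (groupRingSum Set.univ) = ((Q + 1 : ℕ) : MonoidAlgebra ℤ (G ⧸ U)) * W := by
    ext h
    rw [coeff_mapDomainRingHom_groupRingSum, ncard_fiber_mk, hU, coeff_natCast_mul, hW,
      coeff_groupRingSum, if_pos (Set.mem_univ h), mul_one]
  -- `Q ^ 2 ≡ -1` modulo the order of `G ⧸ U`, and `D` is fixed by `Q ^ 2`.
  have hXinv : groupRingInv X = X := by
    rw [← powMap_eq_groupRingInv hinvH, hX, ← mapDomainRingHom_powMap, powMap_groupRingSum hinj,
      hDQ]
  have hXX : X * X = ((Q + 1 : ℕ) : MonoidAlgebra ℤ (G ⧸ U)) * (((Q + 1 : ℕ) :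
      MonoidAlgebra ℤ (G ⧸ U)) * W) + ((Q ^ 2 : ℕ) : MonoidAlgebra ℤ (G ⧸ U)) := by
    have h1 : X * groupRingInv X = f (groupRingSum D * groupRingInv (groupRingSum D)) := by
      rw [map_mul, hX, mapDomainRingHom_groupRingInv]
    rw [hXinv] at h1
    rw [h1, hD.mul_inv_eq, map_add, map_zsmul, map_zsmul, hfW, map_one, zsmul_eq_mul, zsmul_eq_mul,
      mul_one]
    congr 1
    push_cast
    ring
  have hXW : X * W = ((Q ^ 2 + Q + 1 : ℕ) : MonoidAlgebra ℤ (G ⧸ U)) * W := by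
    rw [hW, mul_groupRingSum_univ, hX, augmentation_mapDomainRingHom, augmentation_groupRingSum,
      hD.card_set, Int.cast_natCast]
  have hWW : W * W = ((Q ^ 2 + 1 : ℕ) : MonoidAlgebra ℤ (G ⧸ U)) * W := by
    rw [hW, mul_groupRingSum_univ, augmentation_groupRingSum, Set.ncard_univ, hcardH,
      Int.cast_natCast]
  -- The multiples of `W` cancel: `(Q + 1) ^ 2 - 2 * (Q ^ 2 + Q + 1) + (Q ^ 2 + 1) = 0`.
  have hYY : (X - W) ^ 2 = (p : MonoidAlgebra ℤ (G ⧸ U)) ^ (2 * e) := by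
    have h1 : (X - W) ^ 2 = X * X - 2 * (X * W) + W * W := by ring
    rw [h1, hXX, hXW, hWW, mul_comm 2 e, pow_mul, ← Nat.cast_pow, ← hQ]
    push_cast
    ring
  obtain ⟨Z, hZ⟩ := groupRing_pow_dvd_of_pow_dvd_sq hp (show 0 < 4 * e by omega) hinvH'
    (a := e)
    (x := X - W) (dvd_of_eq hYY.symm)
  rw [← Nat.cast_pow, ← hQ] at hZ
  have hZZ : Z * Z = 1 := by
    rw [← sub_eq_zero]
    apply natCast_mul_eq_zero (pow_ne_zero 2 hQ0.ne')
    rw [hZ, mul_comm 2 e, pow_mul, ← Nat.cast_pow, ← hQ] at hYY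
    have h1 : ∀ q : MonoidAlgebra ℤ (G ⧸ U), q ^ 2 * (Z * Z - 1) = (q * Z) ^ 2 - q ^ 2 := by
      intro q; ring
    rw [Nat.cast_pow, h1, hYY, sub_self]
  have hXcoeff : ∀ h, X.coeff h = 1 + Q * Z.coeff h := by
    intro h
    rw [eq_add_of_sub_eq hZ, coeff_add, Finsupp.add_apply, coeff_natCast_mul, hW,
      coeff_groupRingSum, if_pos (Set.mem_univ h), add_comm]
  have hZinv : groupRingInv Z = Z := by
    ext h
    have h1 := hXcoeff h
    have h2 := hXcoeff h⁻¹
    rw [← coeff_groupRingInv, hXinv, h1] at h2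
    rw [coeff_groupRingInv]
    have hQ' : (Q : ℤ) ≠ 0 := by exact_mod_cast hQ0.ne'
    exact (mul_left_cancel₀ hQ' (add_left_cancel h2)).symm
  obtain ⟨b, hb⟩ : ∃ b, ∀ h, Z.coeff h = if h = b then 1 else 0 := by
    apply exists_eq_single_of_sum_sq_eq_one
    · have h1 := congrArg augmentation hZ
      rw [map_sub, hX, augmentation_mapDomainRingHom, augmentation_groupRingSum, hD.card_set, hW,
        augmentation_groupRingSum, Set.ncard_univ, hcardH, map_mul, map_natCast,
        augmentation_eq_sum Z] at h1
      have hQ' : (Q : ℤ) ≠ 0 := by exact_mod_cast hQ0.ne'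
      apply mul_left_cancel₀ hQ'
      rw [← h1]
      push_cast
      ring
    -- As `Z` is symmetric, the coefficient of `Z * Z = 1` at the identity is its sum of squares.
    · have h1 := coeff_mul_groupRingInv Z Z 1
      rw [hZinv, hZZ, coeff_one_one] at h1
      simpa [sq] using h1.symm
  have hZb : Z = single b 1 := by
    ext h
    rw [hb, coeff_single, Finsupp.single_apply]
    simp only [eq_comm]
  have hb2 : b ^ 2 = 1 := by
    rw [hZb, single_mul_single, mul_one, one_def, single_left_inj one_ne_zero] at hZZ
    rw [sq, hZZ]
  obtain ⟨c, rfl⟩ := QuotientGroup.mk'_surjective U b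
  have hcount : ∀ x : G, {y ∈ D | x⁻¹ * y ∈ U}.ncard = if c⁻¹ * x ∈ U then Q + 1 else 1 := by
    intro x
    have h1 := hXcoeff (QuotientGroup.mk' U x)
    rw [hX, coeff_mapDomainRingHom_groupRingSum, hb] at h1
    have h2 : {y ∈ D | x⁻¹ * y ∈ U} = {y ∈ D | QuotientGroup.mk' U y = QuotientGroup.mk' U x} := by
      ext y
      simp [eq_comm (b := (x : G ⧸ U)), QuotientGroup.eq]
    have h3 : QuotientGroup.mk' U x = QuotientGroup.mk' U c ↔ c⁻¹ * x ∈ U := by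
      simp [eq_comm (b := (c : G ⧸ U)), QuotientGroup.eq]
    rw [h2]
    simp only [h3] at h1
    split_ifs with h4 <;> simp only [h4, if_true, if_false] at h1 <;> omega
  refine ⟨c, ?_, ?_, ?_⟩
  · rw [← map_pow] at hb2
    exact (QuotientGroup.eq_one_iff _).1 hb2
  · have h1 := hcount c
    rw [if_pos (by simp)] at h1
    have h2 : {y ∈ D | c⁻¹ * y ∈ U} = (fun u => c * u) '' (U : Set G) := by
      apply Set.eq_of_subset_of_ncard_le
      · rintro y ⟨_, hy⟩
        exact ⟨_, hy, by simp⟩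
      · rw [h1, Set.ncard_image_of_injective _ (mul_right_injective c), ← hU]
        rfl
      · exact Set.toFinite _
    intro u hu
    have h3 : c * u ∈ (fun u => c * u) '' (U : Set G) := ⟨u, hu, rfl⟩
    rw [← h2] at h3
    exact h3.1
  · intro x hx
    have h1 := hcount x
    rw [if_neg hx] at h1
    exact Set.ncard_eq_one.1 h1

end CosetStructure

/-! ### Arithmetic of `n ^ s + 1` -/

section Arithmetic

theorem pow_four_sub_one_div {n : ℕ} (hn : 2 ≤ n) :
    (n ^ 4 - 1) / (n - 1) = (n + 1) * (n ^ 2 + 1) := by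
  obtain ⟨m, rfl⟩ : ∃ m, n = m + 1 := ⟨n - 1, by omega⟩
  apply Nat.div_eq_of_eq_mul_left (by omega)
  rw [Nat.add_sub_cancel, Nat.sub_eq_iff_eq_add (Nat.one_le_pow _ _ (by omega))]
  ring

theorem pow_three_sub_one_div {n : ℕ} (hn : 2 ≤ n) :
    (n ^ 3 - 1) / (n - 1) = n ^ 2 + n + 1 := by
  obtain ⟨m, rfl⟩ : ∃ m, n = m + 1 := ⟨n - 1, by omega⟩
  apply Nat.div_eq_of_eq_mul_left (by omega)
  rw [Nat.add_sub_cancel, Nat.sub_eq_iff_eq_add (Nat.one_le_pow _ _ (by omega))]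
  ring

theorem pow_two_sub_one_div {n : ℕ} (hn : 2 ≤ n) : (n ^ 2 - 1) / (n - 1) = n + 1 := by
  obtain ⟨m, rfl⟩ : ∃ m, n = m + 1 := ⟨n - 1, by omega⟩
  apply Nat.div_eq_of_eq_mul_left (by omega)
  rw [Nat.add_sub_cancel, Nat.sub_eq_iff_eq_add (Nat.one_le_pow _ _ (by omega))]
  ring

/-- The cofactor is `n ^ (s - 1) - n ^ (s - 2) + ... + 1`, and `n ≡ -1` mod `n + 1`. Going from `s`
to `s + 2` replaces `r` by `n ^ 2 * r - (n - 1)`, which stays odd because `n * (n - 1)` is even. -/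
theorem exists_pow_add_one_eq_mul {n s : ℕ} (hs : Odd s) :
    ∃ r : ℕ, n ^ s + 1 = (n + 1) * r ∧ Odd r ∧ ((n : ℤ) + 1) ∣ r - s := by
  obtain ⟨t, rfl⟩ := hs
  have key : ∃ r : ℤ, (n : ℤ) ^ (2 * t + 1) + 1 = (n + 1) * r ∧ Odd r ∧
      ((n : ℤ) + 1) ∣ r - (2 * t + 1) := by
    induction t with
    | zero => exact ⟨1, by simp⟩
    | succ t ih =>
      obtain ⟨r, h1, ⟨k, hk⟩, ⟨m, hm⟩⟩ := ih
      refine ⟨n ^ 2 * r - (n - 1), ?_, ?_, n * r - r + m - 1, ?_⟩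
      · have : (n : ℤ) ^ (2 * (t + 1) + 1) + 1 = n ^ 2 * (n ^ (2 * t + 1) + 1) - (n ^ 2 - 1) := by
          ring
        rw [this, h1]; ring
      · subst hk
        obtain ⟨j, hj⟩ := Int.even_mul_succ_self ((n : ℤ) - 1)
        exact ⟨n ^ 2 * k + j, by linear_combination hj⟩
      · push_cast
        linear_combination hm
  obtain ⟨r, h1, h2, h3⟩ := key
  have hr : 0 ≤ r := by
    by_contra! h
    have : ((n : ℤ) + 1) * r < 0 := mul_neg_of_pos_of_neg (by positivity) h
    have : (0 : ℤ) ≤ (n : ℤ) ^ (2 * t + 1) := by positivity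
    omega
  lift r to ℕ using hr
  refine ⟨r, by exact_mod_cast h1, by exact_mod_cast h2, by exact_mod_cast h3⟩

/-- If `l ∣ n + 1`, then `l ∣ s`, so `l = s`, which is excluded. If `l ∣ n - 1`, then `n ^ s + 1 ≡
2`, so `l = 2`, but `r` is odd. With `n = q ^ 2` this makes the cofactor prime to `q ^ 4 - 1`. -/
theorem not_prime_dvd_cofactor {n s r l : ℕ} (hs : s.Prime) (hsn : ¬ s ∣ n + 1)
    (hr : n ^ s + 1 = (n + 1) * r) (hodd : Odd r) (hmod : ((n : ℤ) + 1) ∣ r - s)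
    (hl : l.Prime) (hlr : l ∣ r) : ¬ (l : ℤ) ∣ (n : ℤ) ^ 2 - 1 := by
  intro h
  have hfac : (n : ℤ) ^ 2 - 1 = (n + 1) * (n - 1) := by ring
  rw [hfac] at h
  obtain h | h := (Nat.prime_iff_prime_int.1 hl).dvd_or_dvd h
  · have h1 : (l : ℤ) ∣ s := by
      have h2 := h.trans hmod
      have h3 : (l : ℤ) ∣ r := by exact_mod_cast hlr
      exact (dvd_sub_right h3).1 h2
    have h2 : l = s := (Nat.prime_dvd_prime_iff_eq hl hs).1 (by exact_mod_cast h1)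
    apply hsn
    rw [← h2]
    exact_mod_cast h
  · have h1 : (l : ℤ) ∣ (n : ℤ) ^ s + 1 := by
      have : l ∣ n ^ s + 1 := hr ▸ hlr.mul_left _
      exact_mod_cast this
    have h2 : (l : ℤ) ∣ (n : ℤ) ^ s - 1 := by
      have := h.trans (sub_dvd_pow_sub_pow (n : ℤ) 1 s)
      simpa using this
    have h3 : (l : ℤ) ∣ 2 := by
      have := dvd_sub h1 h2
      have h4 : (n : ℤ) ^ s + 1 - (n ^ s - 1) = 2 := by ring
      rwa [h4] at this
    have h4 : l = 2 := (Nat.prime_dvd_prime_iff_eq hl Nat.prime_two).1 (by exact_mod_cast h3)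
    rw [h4] at hlr
    exact (Nat.not_even_iff_odd.2 hodd) (even_iff_two_dvd.2 hlr)

/-- `q ^ 2 + 1` divides `q ^ (2 * s) + 1`, so it would divide `2`. This keeps `M` from lying inside
`U`. -/
theorem not_sq_add_one_dvd_pow_add_one {q s : ℕ} (hq : 2 ≤ q) (hs : Odd s) :
    ¬ q ^ 2 + 1 ∣ q ^ s + 1 := by
  intro h
  obtain ⟨r, hr, -⟩ := exists_pow_add_one_eq_mul (n := q ^ 2) hs
  have h1 : ((q ^ 2 + 1 : ℕ) : ℤ) ∣ (q : ℤ) ^ s + 1 := by exact_mod_cast h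
  have h2 : ((q ^ 2 + 1 : ℕ) : ℤ) ∣ ((q : ℤ) ^ s) ^ 2 + 1 := by
    rw [← pow_mul, mul_comm s 2, pow_mul]
    exact ⟨r, by exact_mod_cast hr⟩
  have h3 : ((q ^ 2 + 1 : ℕ) : ℤ) ∣ 2 := by
    have := dvd_sub h2 (h1.mul_right ((q : ℤ) ^ s - 1))
    have h4 : ((q : ℤ) ^ s) ^ 2 + 1 - (q ^ s + 1) * (q ^ s - 1) = 2 := by ring
    rwa [h4] at this
  have h5 := Nat.le_of_dvd two_pos (show q ^ 2 + 1 ∣ 2 by exact_mod_cast h3)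
  nlinarith

/-- `q ^ s - q` is a multiple of `q * (q - 1) * (q + 1)`, and `q * (q - 1)` is even. -/
theorem two_mul_add_one_dvd_pow_sub {q s : ℕ} (hs : Odd s) : 2 * (q + 1) ∣ q ^ s - q := by
  obtain ⟨t, rfl⟩ := hs
  rcases Nat.eq_zero_or_pos q with rfl | hq
  · simp
  have hle : q ≤ q ^ (2 * t + 1) := Nat.le_self_pow (by omega) q
  zify [hle]
  obtain ⟨j, hj⟩ := Int.even_mul_succ_self ((q : ℤ) - 1)
  obtain ⟨k, hk⟩ : (q : ℤ) ^ 2 - 1 ∣ ((q : ℤ) ^ 2) ^ t - 1 := by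
    simpa using sub_dvd_pow_sub_pow ((q : ℤ) ^ 2) 1 t
  refine ⟨j * k, ?_⟩
  rw [pow_succ, pow_mul]
  linear_combination (q : ℤ) * hk + (q + 1) * k * hj

end Arithmetic

/-! ### Subgroups of given order and products over orbits -/

section Subgroups

theorem exists_subgroup_card_eq (d : ℕ) : ∀ {A : Type*} [CommGroup A] [Finite A],
    d ∣ Nat.card A → ∃ U : Subgroup A, Nat.card U = d := by
  induction d using Nat.strong_induction_on with
  | _ d ih =>
    intro A _ _ hd
    by_cases h1 : d = 1
    · exact ⟨⊥, by simp [h1]⟩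
    obtain ⟨l, hl, k, rfl⟩ := Nat.exists_prime_and_dvd h1
    have hA : 0 < Nat.card A := Nat.card_pos
    have hk : 0 < k := by
      rcases Nat.eq_zero_or_pos k with rfl | h
      · simp at hd; omega
      · exact h
    have : Fact l.Prime := ⟨hl⟩
    obtain ⟨x, hx⟩ := exists_prime_orderOf_dvd_card' l ((dvd_mul_right l k).trans hd)
    let Z := Subgroup.zpowers x
    have hZ : Nat.card Z = l := by rw [Nat.card_zpowers, hx]
    have hquot := Z.card_eq_card_quotient_mul_card_subgroup
    rw [hZ, mul_comm] at hquot
    rw [hquot] at hd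
    obtain ⟨V, hV⟩ := ih k (by nlinarith [hl.two_le]) (A := A ⧸ Z)
      (Nat.dvd_of_mul_dvd_mul_left hl.pos hd)
    refine ⟨V.comap (QuotientGroup.mk' Z), ?_⟩
    have h2 := Subgroup.card_mul_index (V.comap (QuotientGroup.mk' Z))
    rw [Subgroup.index_comap_of_surjective _ (QuotientGroup.mk'_surjective Z), hquot,
      ← V.card_mul_index, hV, ← mul_assoc] at h2
    exact Nat.eq_of_mul_eq_mul_right (Nat.pos_of_ne_zero V.index_ne_zero_of_finite) h2

/-- By `hne`, every orbit of `x ↦ x ^ n` has exactly four elements, with product `x ^ (1 + n + n ^ 2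
+ n ^ 3)`, and this exponent is `(n + 1) * (n ^ 2 + 1)`. -/
theorem finset_prod_eq_one_of_pow_orbits {A : Type*} [CommGroup A] {n : ℕ}
    (h4 : ∀ x : A, x ^ n ^ 4 = x) (h1 : ∀ x : A, x ^ ((n + 1) * (n ^ 2 + 1)) = 1) (S : Finset A)
    (hS : ∀ x ∈ S, x ^ n ∈ S) (hne : ∀ x ∈ S, x ^ n ^ 2 ≠ x) : ∏ x ∈ S, x = 1 := by
  classical
  induction S using Finset.strongInduction with
  | H S ih =>
    rcases S.eq_empty_or_nonempty with rfl | ⟨x, hx⟩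
    · simp
    have hx2 : (x ^ n) ^ n = x ^ n ^ 2 := by rw [← pow_mul]; ring_nf
    have hx3 : ((x ^ n) ^ n) ^ n = x ^ n ^ 3 := by rw [← pow_mul, ← pow_mul]; ring_nf
    have hx4 : (((x ^ n) ^ n) ^ n) ^ n = x := by
      rw [← pow_mul, ← pow_mul, ← pow_mul]
      refine Eq.trans ?_ (h4 x)
      ring_nf
    have hinj : ∀ y z : A, y ^ n = z ^ n → y = z := by
      intro y z h
      rw [← h4 y, ← h4 z, pow_succ', pow_mul, pow_mul, h]
    set a := x ^ n with ha
    set b := a ^ n with hb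
    set c := b ^ n with hc
    have haS : a ∈ S := hS _ hx
    have hbS : b ∈ S := hS _ haS
    have hcS : c ∈ S := hS _ hbS
    have hxb : x ≠ b := fun h => hne x hx (hx2 ▸ h.symm)
    have hxa : x ≠ a := fun h => hxb (by rw [hb, ← h, ← ha]; exact h)
    have hac : a ≠ c := fun h => hxb (hinj _ _ h)
    have hab : a ≠ b := fun h => hxa (hinj _ _ h)
    have hbc : b ≠ c := fun h => hab (hinj _ _ h)
    have hxc : x ≠ c := fun h => hxa (by rw [← hx4, ← h])
    set O : Finset A := {x, a, b, c} with hO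
    have hOS : O ⊆ S := by
      intro y hy
      simp only [hO, Finset.mem_insert, Finset.mem_singleton] at hy
      rcases hy with rfl | rfl | rfl | rfl <;> assumption
    have hOprod : ∏ y ∈ O, y = 1 := by
      rw [hO, Finset.prod_insert (by simp [hxa, hxb, hxc]), Finset.prod_insert (by simp [hab, hac]),
        Finset.prod_insert (by simp [hbc]), Finset.prod_singleton, hx3, hx2, ha, ← pow_add,
        ← pow_add, ← pow_succ']
      refine Eq.trans ?_ (h1 x)
      ring_nf
    rw [← Finset.prod_sdiff hOS, hOprod, mul_one]
    apply ih
    · exact Finset.sdiff_ssubset hOS ⟨x, by simp [hO]⟩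
    · intro y hy
      rw [Finset.mem_sdiff] at hy ⊢
      refine ⟨hS y hy.1, fun h => hy.2 ?_⟩
      simp only [hO, Finset.mem_insert, Finset.mem_singleton] at h ⊢
      rcases h with h | h | h | h
      · exact Or.inr (Or.inr (Or.inr (hinj _ _ (h.trans hx4.symm))))
      · exact Or.inl (hinj _ _ h)
      · exact Or.inr (Or.inl (hinj _ _ h))
      · exact Or.inr (Or.inr (Or.inl (hinj _ _ h)))
    · intro y hy
      exact hne y (Finset.mem_sdiff.1 hy).1

end Subgroups

/-! ### Double counting of quotients -/

section Counting
open MonoidAlgebra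

variable {A : Type*} [CommGroup A] [Finite A]

theorem sum_ncard_differences [Fintype A] (E : Set A) :
    ∑ g, {b ∈ E | g * b ∈ E}.ncard = E.ncard ^ 2 := by
  have h := augmentation_eq_sum (groupRingSum E * groupRingInv (groupRingSum E))
  simp only [coeff_groupRingSum_mul_inv, map_mul, augmentation_groupRingInv,
    augmentation_groupRingSum] at h
  rw [sq]
  exact_mod_cast h.symm

/-- Suppose that `E` contains the coset `c V`, meets every other coset of `V` in one
element, and that the number of ways to write `g ∉ V` as a quotient of elements of `E` is
congruent to `q + 1` modulo `s ≥ q`. If `V` has index at most `q ^ 2 + 1` and the group is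
large enough, then `E` is a difference set with classical parameters. -/
theorem isDifferenceSet_of_coset_structure {E : Set A} {V : Subgroup A} {c : A} {q s : ℕ}
    (hq : 2 ≤ q) (hqs : q ≤ s) (hcE : ∀ u ∈ V, c * u ∈ E)
    (hE : ∀ x, c⁻¹ * x ∉ V → ∃ d, {y ∈ E | x⁻¹ * y ∈ V} = {d})
    (hmod : ∀ g ∉ V, {b ∈ E | g * b ∈ E}.ncard ≡ q + 1 [MOD s]) (hidx : V.index ≠ 1)
    (hidx_le : V.index ≤ q ^ 2 + 1) (hcard : (q + 1) * (q ^ 2 + 1) ≤ Nat.card A) :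
    IsDifferenceSet ((q + 1) * (q ^ 2 + 1)) (q ^ 2 + q + 1) (q + 1) E ∧ Nat.card V = q + 1 := by
  classical
  have := Fintype.ofFinite A
  have := Fintype.ofFinite (A ⧸ V)
  obtain ⟨r, hr⟩ : ∃ r : A → ℕ, ∀ g, r g = {b ∈ E | g * b ∈ E}.ncard := ⟨_, fun _ => rfl⟩
  have hcoset : ∀ x y : A, QuotientGroup.mk' V y = QuotientGroup.mk' V x ↔ x⁻¹ * y ∈ V := by
    intro x y
    simp [eq_comm (b := (x : A ⧸ V)), QuotientGroup.eq]
  have hcV : {y ∈ E | c⁻¹ * y ∈ V} = (fun u => c * u) '' (V : Set A) := by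
    ext y
    constructor
    · rintro ⟨_, hy⟩
      exact ⟨_, hy, by simp⟩
    · rintro ⟨u, hu, rfl⟩
      exact ⟨hcE u hu, by simpa using hu⟩
  have hcVcard : {y ∈ E | c⁻¹ * y ∈ V}.ncard = Nat.card V := by
    rw [hcV, Set.ncard_image_of_injective _ (mul_right_injective c)]
    rfl
  have hidx0 : 0 < V.index := Nat.pos_of_ne_zero V.index_ne_zero_of_finite
  obtain ⟨f, hf⟩ : ∃ f, f = Nat.card V := ⟨_, rfl⟩
  have hf0 : 0 < f := hf ▸ Nat.card_pos
  obtain ⟨a, ha⟩ : ∃ a, V.index = a + 1 := ⟨V.index - 1, by omega⟩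
  have ha0 : 0 < a := by omega
  have hEcard : E.ncard = f + a := by
    have h1 := augmentation_mapDomainRingHom (QuotientGroup.mk' V) (groupRingSum E)
    rw [augmentation_groupRingSum, augmentation_eq_sum] at h1
    have h2 : ∀ h : A ⧸ V, (mapDomainRingHom ℤ (QuotientGroup.mk' V) (groupRingSum E)).coeff h =
        1 + if h = QuotientGroup.mk' V c then (f : ℤ) - 1 else 0 := by
      intro h
      obtain ⟨x, rfl⟩ := QuotientGroup.mk'_surjective V h
      rw [coeff_mapDomainRingHom_groupRingSum]
      simp only [hcoset]
      split_ifs with h3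
      · have h4 : {y ∈ E | x⁻¹ * y ∈ V} = {y ∈ E | c⁻¹ * y ∈ V} := by
          ext y
          have h5 := hcoset x y
          rw [(hcoset c x).2 h3, hcoset c y] at h5
          simp only [Set.mem_ofPred_eq, h5]
        rw [h4, hcVcard, hf]; ring
      · obtain ⟨d, hd⟩ := hE x h3
        rw [hd, Set.ncard_singleton]; simp
    simp only [h2] at h1
    rw [Finset.sum_add_distrib, Finset.sum_ite_eq' Finset.univ, if_pos (Finset.mem_univ _),
      Finset.sum_const, Finset.card_univ, ← Nat.card_eq_fintype_card, ← Subgroup.index_eq_card,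
      ha] at h1
    simp at h1
    omega
  have hr1 : r 1 = f + a := by
    rw [hr, ← hEcard]; simp
  -- Here `b` and `g * b` are distinct and lie in one coset of `V`, which must be `c V`.
  have hrV : ∀ g ∈ V, g ≠ 1 → r g = f := by
    intro g hg hg1
    rw [hr, hf, ← hcVcard]
    congr 1
    ext b
    simp only [Set.mem_ofPred_eq]
    refine and_congr_right fun hb => ⟨fun hgb => ?_, fun hcb => ?_⟩
    · by_contra hcb
      obtain ⟨d, hd⟩ := hE b hcb
      have h1 : b ∈ ({d} : Set A) := hd ▸ ⟨hb, by simp⟩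
      have h2 : g * b ∈ ({d} : Set A) := hd ▸ ⟨hgb, by simpa [mul_comm g b] using hg⟩
      rw [Set.mem_singleton_iff] at h1 h2
      rw [← h1] at h2
      exact hg1 (by simpa using h2)
    · have h1 := hcE (g * (c⁻¹ * b)) (V.mul_mem hg hcb)
      have h2 : c * (g * (c⁻¹ * b)) = g * b := by
        rw [mul_left_comm, mul_inv_cancel_left]
      rwa [h2] at h1
  have hrlow : ∀ g ∉ V, q + 1 ≤ r g := by
    intro g hg
    -- One representation has its numerator in `c V`, another its denominator. The bound `2`
    -- suffices even when `s = q`: a value in `[2, q]` would differ from `q + 1` by less than `s`.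
    have htwo : 2 ≤ r g := by
      have hg1 : c⁻¹ * (g⁻¹ * c) ∉ V := by
        have : c⁻¹ * (g⁻¹ * c) = g⁻¹ := by rw [mul_left_comm]; simp
        rw [this]; simpa using hg
      have hg2 : c⁻¹ * (g * c) ∉ V := by
        have : c⁻¹ * (g * c) = g := by rw [mul_left_comm]; simp
        rw [this]; exact hg
      obtain ⟨x, hx⟩ := hE _ hg1
      obtain ⟨y, hy⟩ := hE _ hg2
      obtain ⟨hxE, hxV⟩ : x ∈ {y ∈ E | (g⁻¹ * c)⁻¹ * y ∈ V} := by rw [hx]; rfl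
      obtain ⟨hyE, hyV⟩ : y ∈ {z ∈ E | (g * c)⁻¹ * z ∈ V} := by rw [hy]; rfl
      have e1 : (g⁻¹ * c)⁻¹ * x = c⁻¹ * (g * x) := by
        rw [mul_inv, inv_inv, mul_comm g, mul_assoc]
      have e2 : (g * c)⁻¹ * y = c⁻¹ * (g⁻¹ * y) := by
        rw [mul_inv, mul_comm g⁻¹, mul_assoc]
      rw [e1] at hxV
      rw [e2] at hyV
      have hgx : g * x ∈ E := by simpa using hcE _ hxV
      have hgy : g⁻¹ * y ∈ E := by simpa using hcE _ hyV
      have hxy : x ≠ g⁻¹ * y := by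
        intro h
        rw [← h] at hyV
        have := V.mul_mem hxV (V.inv_mem hyV)
        apply hg
        convert this using 1
        rw [mul_left_comm, mul_inv_cancel_right]
      rw [hr, ← Set.ncard_pair hxy]
      apply Set.ncard_le_ncard _ (Set.toFinite _)
      rintro z (rfl | rfl)
      · exact ⟨hxE, hgx⟩
      · exact ⟨hgy, by simpa using hyE⟩
    have h1 := hmod g hg
    rw [← hr] at h1
    by_contra! h2
    have h3 := (Nat.modEq_iff_dvd' h2.le).1 h1
    have h4 := Nat.le_of_dvd (by omega) h3
    omega
  have hcardA : Nat.card A = f * (a + 1) := by rw [hf, ← ha, V.card_mul_index]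
  have hsplit := Finset.sum_filter_add_sum_filter_not Finset.univ (· ∈ V) r
  have htot : ∑ g, r g = (f + a) ^ 2 := by
    rw [← hEcard, ← sum_ncard_differences]; exact Finset.sum_congr rfl fun g _ => hr g
  have hVfilter : (Finset.univ.filter (· ∈ V)).card = f := by
    rw [hf, Nat.card_eq_fintype_card, Fintype.card_subtype]
  have hsumV : ∑ g with g ∈ V, r g = f ^ 2 + a := by
    have hmem : (1 : A) ∈ Finset.univ.filter (· ∈ V) := by simp [V.one_mem]
    rw [← Finset.add_sum_erase _ _ hmem, hr1, Finset.sum_congr rfl (g := fun _ => f),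
      Finset.sum_const, Finset.card_erase_of_mem hmem, hVfilter, smul_eq_mul]
    · obtain ⟨f', rfl⟩ : ∃ f', f = f' + 1 := ⟨f - 1, by omega⟩
      rw [Nat.add_sub_cancel]; ring
    · intro g hg
      rw [Finset.mem_erase, Finset.mem_filter] at hg
      exact hrV g hg.2.2 hg.1
  have hVcompl : (Finset.univ.filter (· ∉ V)).card = f * a := by
    have h1 := Finset.card_filter_add_card_filter_not (s := (Finset.univ : Finset A)) (· ∈ V)
    rw [hVfilter, Finset.card_univ, ← Nat.card_eq_fintype_card, hcardA] at h1
    linarith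
  have hsumcompl : (∑ g with g ∉ V, r g) + f ^ 2 + a = (f + a) ^ 2 := by
    rw [hsumV, htot] at hsplit; linarith
  have hlow : f * a * (q + 1) ≤ ∑ g with g ∉ V, r g := by
    rw [← hVcompl, ← smul_eq_mul]
    exact Finset.card_nsmul_le_sum _ _ _ fun g hg => hrlow g (Finset.mem_filter.1 hg).2
  have haq : a ≤ q ^ 2 := by omega
  -- The quotients outside `V` number `2 * f * a + a ^ 2 - a`, at least `f * a * (q + 1)`.
  -- Cancelling `a ≤ q ^ 2` leaves `f * (q - 1) ≤ q ^ 2 - 1`.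
  have hfq : f ≤ q + 1 := by
    have h1 : a * (f * (q + 1) + 1) ≤ a * (2 * f + a) := by nlinarith
    have h2 := Nat.le_of_mul_le_mul_left h1 ha0
    obtain ⟨j, rfl⟩ : ∃ j, q = j + 2 := ⟨q - 2, by omega⟩
    have h3 : f * (j + 1) ≤ (j + 3) * (j + 1) := by nlinarith
    have := Nat.le_of_mul_le_mul_right h3 (by omega)
    omega
  rw [hcardA] at hcard
  have haeq : a = q ^ 2 := by
    refine le_antisymm haq ?_
    by_contra! h
    have h1 : f * (a + 1) ≤ (q + 1) * (a + 1) := Nat.mul_le_mul_right _ hfq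
    nlinarith
  have hfeq : f = q + 1 := by
    refine le_antisymm hfq ?_
    rw [haeq] at hcard
    exact Nat.le_of_mul_le_mul_right hcard (by omega)
  have hcompl : ∀ g ∉ V, r g = q + 1 := by
    have h1 : ∑ g with g ∉ V, (q + 1) = ∑ g with g ∉ V, r g := by
      rw [Finset.sum_const, hVcompl, smul_eq_mul]
      rw [haeq, hfeq] at hsumcompl ⊢
      linarith
    have h2 := (Finset.sum_eq_sum_iff_of_le
      (fun g hg => hrlow g (Finset.mem_filter.1 hg).2)).1 h1
    intro g hg
    exact (h2 g (by simpa using hg)).symm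
  refine ⟨isDifferenceSet_iff.2 ⟨?_, ?_, by omega, fun g hg => ?_⟩, hf ▸ hfeq⟩
  · rw [hcardA, haeq, hfeq]
  · rw [hEcard, haeq, hfeq]; ring
  · rw [← hr]
    by_cases hgV : g ∈ V
    · rw [hrV g hgV hg, hfeq]
    · exact hcompl g hgV

end Counting

/-! ### Fixed points of multipliers -/

section Multipliers

variable {A : Type*} [CommGroup A]

theorem mem_of_sq_mem_of_odd {V : Subgroup A} {x : A} {m : ℕ} (hm : Odd m) (h : x ^ m ∈ V)
    (h2 : x ^ 2 ∈ V) : x ∈ V := by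
  obtain ⟨k, rfl⟩ := hm
  rw [pow_succ, pow_mul] at h
  exact (V.mul_mem_cancel_left (V.pow_mem h2 k)).1 h

theorem pow_mem_of_pow_mem {D : Set A} {p : ℕ} (hD : ∀ x ∈ D, x ^ p ∈ D) (k : ℕ) :
    ∀ x ∈ D, x ^ p ^ k ∈ D := by
  induction k with
  | zero => simp
  | succ k ih =>
    intro x hx
    rw [pow_succ, pow_mul]
    exact hD _ (ih x hx)

variable [Finite A]

/-- As `g` is fixed, `b ↦ b ^ t` permutes these `b`, and its `s`-th iterate is the identity: orbits
have length `1` or `s`. -/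
theorem ncard_differences_modEq_ncard_fixed {D : Set A} {t s : ℕ} (hs : s.Prime)
    (ht : ∀ x : A, x ^ t ^ s = x) (hD : ∀ x ∈ D, x ^ t ∈ D) {g : A} (hg : g ^ t = g) :
    {b ∈ D | g * b ∈ D}.ncard ≡ {b ∈ D | g * b ∈ D ∧ b ^ t = b}.ncard [MOD s] := by
  classical
  have := Fintype.ofFinite A
  have : Fact s.Prime := ⟨hs⟩
  let α := {b : A // b ∈ D ∧ g * b ∈ D}
  let f : Function.End α := fun b =>
    ⟨b.1 ^ t, hD _ b.2.1, by
      have := hD _ b.2.2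
      rwa [mul_pow, hg] at this⟩
  have hfk : ∀ (k : ℕ) (b : α), ((f ^ k) b).1 = b.1 ^ t ^ k := by
    intro k
    induction k with
    | zero => intro b; rw [pow_zero, pow_zero, pow_one]; rfl
    | succ k ih =>
      intro b
      rw [pow_succ, pow_succ', pow_mul]
      exact ih (f b)
  have hf : f ^ s ^ 1 = 1 := by
    funext b
    apply Subtype.ext
    rw [pow_one, hfk, ht]
    rfl
  have h := Equiv.Perm.card_fixedPoints_modEq hf
  have h1 : {b ∈ D | g * b ∈ D}.ncard = Fintype.card α := by
    rw [← Nat.card_eq_fintype_card]; rfl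
  have h2 : {b ∈ D | g * b ∈ D ∧ b ^ t = b}.ncard = Fintype.card (Function.fixedPoints f) := by
    rw [← Nat.card_eq_fintype_card]
    refine Nat.card_congr ⟨fun b => ⟨⟨b.1, b.2.1, b.2.2.1⟩, Subtype.ext b.2.2.2⟩,
      fun b => ⟨b.1.1, b.1.2.1, b.1.2.2, congrArg Subtype.val b.2⟩, fun _ => rfl, fun _ => rfl⟩
  rw [h1, h2]
  exact h

/-- `F ⧸ (U ∩ F)` has exponent dividing `n`, so by Cauchy its order shares no prime with `r`. -/
theorem index_subgroupOf_dvd {U F : Subgroup A} {n a r : ℕ} (hF : ∀ x ∈ F, x ^ n = 1)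
    (hU : U.index = a * r) (hr : ∀ l : ℕ, l.Prime → l ∣ r → ¬ l ∣ n) :
    (U.subgroupOf F).index ∣ a := by
  have h1 : (U.subgroupOf F).index ∣ a * r := hU ▸ U.relIndex_dvd_index_of_normal F
  refine Nat.Coprime.dvd_of_dvd_mul_right (Nat.coprime_of_dvd fun l hl hl1 hl2 => ?_) h1
  have : Fact l.Prime := ⟨hl⟩
  rw [Subgroup.index_eq_card] at hl1
  obtain ⟨x, hx⟩ := exists_prime_orderOf_dvd_card' l hl1
  apply hr l hl hl2
  rw [← hx]
  apply orderOf_dvd_of_pow_eq_one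
  obtain ⟨y, rfl⟩ := QuotientGroup.mk'_surjective _ x
  rw [← map_pow]
  have : y ^ n = 1 := Subtype.ext (hF y.1 y.2)
  rw [this, map_one]

end Multipliers

/-! ### Intersecting with the fixed subgroup -/

section Intersection

variable {G : Type*} [CommGroup G] {D : Set G} {U F : Subgroup G} {c : G} {q s : ℕ}

theorem coe_image_preimage (F : Subgroup G) (S : Set G) :
    (fun x : F => (x : G)) '' ((fun x : F => (x : G)) ⁻¹' S) = S ∩ F := by
  ext x
  constructor
  · rintro ⟨y, hy, rfl⟩
    exact ⟨hy, y.2⟩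
  · rintro ⟨h1, h2⟩
    exact ⟨⟨x, h2⟩, h1, rfl⟩

/-- `x ^ n = x` puts `d ^ n` in the coset of `d`; uniqueness there gives `d ^ n = d`. -/
theorem mem_of_unique_in_coset {n : ℕ} (hF : ∀ x, x ∈ F ↔ x ^ n = x)
    (hDn : ∀ x ∈ D, x ^ n ∈ D) (hc : ∀ x, c⁻¹ * x ∉ U → ∃ d, {y ∈ D | x⁻¹ * y ∈ U} = {d})
    {x d : G} (hx : x ∈ F) (hxU : c⁻¹ * x ∉ U) (hd : d ∈ D) (hxd : x⁻¹ * d ∈ U) : d ∈ F := by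
  obtain ⟨d', hd'⟩ := hc x hxU
  have h1 : d ∈ ({d'} : Set G) := hd' ▸ ⟨hd, hxd⟩
  have h2 : d ^ n ∈ ({d'} : Set G) := by
    rw [← hd']
    refine ⟨hDn d hd, ?_⟩
    have := U.pow_mem hxd n
    rwa [mul_pow, inv_pow, (hF x).1 hx] at this
  rw [Set.mem_singleton_iff] at h1 h2
  exact (hF d).2 (h2.trans h1.symm)

theorem ncard_inter_eq_card_subgroupOf (U F : Subgroup G) :
    ((U : Set G) ∩ F).ncard = Nat.card (U.subgroupOf F) := by
  rw [← coe_image_preimage, Set.ncard_image_of_injective _ Subtype.val_injective]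
  rfl

variable [Finite G]

theorem isDifferenceSet_inter_fixed (hq : 2 ≤ q) (hs : s.Prime) (hqs : q ≤ s)
    (hD : ∀ g : G, g ≠ 1 → {b ∈ D | g * b ∈ D}.ncard = q ^ s + 1)
    (hF : ∀ x, x ∈ F ↔ x ^ q ^ 4 = x) (hDq : ∀ x ∈ D, x ^ q ^ 4 ∈ D)
    (hG : ∀ x : G, x ^ (q ^ 4) ^ s = x) (hcF : c ∈ F) (hcU : ∀ u ∈ U, c * u ∈ D)
    (hc : ∀ x, c⁻¹ * x ∉ U → ∃ d, {y ∈ D | x⁻¹ * y ∈ U} = {d})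
    (hidx : (U.subgroupOf F).index ≠ 1) (hidx_le : (U.subgroupOf F).index ≤ q ^ 2 + 1)
    (hcard : (q + 1) * (q ^ 2 + 1) ≤ Nat.card F) :
    IsDifferenceSet ((q + 1) * (q ^ 2 + 1)) (q ^ 2 + q + 1) (q + 1)
      ((fun x : F => (x : G)) ⁻¹' D) ∧ Nat.card (U.subgroupOf F) = q + 1 := by
  refine isDifferenceSet_of_coset_structure (c := ⟨c, hcF⟩) hq hqs ?_ ?_ ?_ hidx hidx_le hcard
  · intro u hu
    exact hcU u hu
  · intro x hx
    obtain ⟨d, hd⟩ := hc x hx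
    obtain ⟨hdD, hdU⟩ : d ∈ {y ∈ D | (x : G)⁻¹ * y ∈ U} := by rw [hd]; rfl
    refine ⟨⟨d, mem_of_unique_in_coset hF hDq hc x.2 hx hdD hdU⟩, ?_⟩
    ext y
    have : (y : G) ∈ {y ∈ D | (x : G)⁻¹ * y ∈ U} ↔ (y : G) = d := by rw [hd]; rfl
    rw [Set.mem_singleton_iff, Subtype.ext_iff]
    exact this
  · intro g hg
    have hg1 : (g : G) ≠ 1 := by
      intro h
      apply hg
      rw [Subgroup.mem_subgroupOf, h]
      exact U.one_mem
    have h1 := ncard_differences_modEq_ncard_fixed hs hG hDq ((hF g).1 g.2)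
    rw [hD g hg1] at h1
    have h2 : {b ∈ D | (g : G) * b ∈ D ∧ b ^ q ^ 4 = b} = (fun x : F => (x : G)) ''
        {b | b ∈ (fun x : F => (x : G)) ⁻¹' D ∧ g * b ∈ (fun x : F => (x : G)) ⁻¹' D} := by
      ext b
      constructor
      · rintro ⟨hb, hgb, hbF⟩
        exact ⟨⟨b, (hF b).2 hbF⟩, ⟨hb, hgb⟩, rfl⟩
      · rintro ⟨y, ⟨hy, hgy⟩, rfl⟩
        exact ⟨hy, hgy, (hF y).1 y.2⟩
    rw [h2, Set.ncard_image_of_injective _ Subtype.val_injective] at h1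
    -- Fermat: `q ^ s ≡ q` mod `s`.
    refine h1.symm.trans (Nat.ModEq.add_right 1 ?_)
    have : Fact s.Prime := ⟨hs⟩
    rw [← ZMod.natCast_eq_natCast_iff]
    simp

theorem isNormalizedSet_inter {Q : ℕ} (hQpos : 0 < Q) (hnorm : IsNormalizedSet D)
    (hG4 : ∀ x : G, x ^ Q ^ 4 = x)
    (hG1 : ∀ x : G, x ^ ((Q + 1) * (Q ^ 2 + 1)) = 1) (hDQ : ∀ x ∈ D, x ^ Q ∈ D) (hcF : c ∈ F)
    (hc2 : c ^ 2 ∈ U) (hcU : ∀ u ∈ U, c * u ∈ D) (hUidx : U.index = Q ^ 2 + 1)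
    (hUcard : Nat.card U = Q + 1) (hFodd : Odd F.index)
    (hF : ∀ x ∈ F, c⁻¹ * x ∉ U → ∀ d ∈ D, x⁻¹ * d ∈ U → d ∈ F)
    (hUF : Nat.card (U.subgroupOf F) = q + 1) (hcpow : c ^ (Q - q) = 1) :
    IsNormalizedSet ((fun x : F => (x : G)) ⁻¹' D) := by
  classical
  -- `Q ^ 2 + 1` and `Q - 1` have the same parity and `c ^ 2 ∈ U`. Hence `cU` is stable under `x ↦ x
  -- ^ Q`.
  have hcQ : c ^ (Q - 1) ∈ U := by
    have h1 : c ^ (Q ^ 2 + 1) ∈ U := hUidx ▸ U.pow_index_mem c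
    obtain ⟨n, rfl⟩ : ∃ n, Q = n + 1 := ⟨Q - 1, by omega⟩
    obtain ⟨k, hk⟩ := Nat.even_mul_succ_self n
    have h2 : (n + 1) ^ 2 + 1 = n + 2 * (k + 1) := by linarith
    rw [h2, pow_add, pow_mul] at h1
    exact (U.mul_mem_cancel_right (U.pow_mem hc2 _)).1 h1
  have hcosetQ : ∀ x, c⁻¹ * x ∈ U → c⁻¹ * x ^ Q ∈ U := by
    intro x hx
    have h1 := U.mul_mem hcQ (U.pow_mem hx Q)
    obtain ⟨n, rfl⟩ : ∃ n, Q = n + 1 := ⟨Q - 1, by omega⟩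
    have h2 : c ^ (n + 1 - 1) * (c⁻¹ * x) ^ (n + 1) = c⁻¹ * x ^ (n + 1) := by
      rw [Nat.add_sub_cancel, mul_pow, inv_pow, pow_succ c, mul_inv, ← mul_assoc, ← mul_assoc,
        mul_inv_cancel, one_mul]
    rwa [h2] at h1
  have hQ4 : ∀ x : G, (((x ^ Q) ^ Q) ^ Q) ^ Q = x := by
    intro x
    rw [← pow_mul, ← pow_mul, ← pow_mul]
    refine Eq.trans ?_ (hG4 x)
    ring_nf
  set S : Set G := {x | x ∈ D ∧ x ∉ F ∧ c⁻¹ * x ∉ U} with hS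
  have hSprod : ∏ᶠ x ∈ S, x = 1 := by
    rw [finprod_mem_eq_finite_toFinset_prod _ (Set.toFinite S)]
    apply finset_prod_eq_one_of_pow_orbits hG4 hG1
    · intro x hx
      rw [Set.Finite.mem_toFinset] at hx ⊢
      refine ⟨hDQ x hx.1, fun h => hx.2.1 ?_, fun h => hx.2.2 ?_⟩
      · rw [← hQ4 x]
        exact F.pow_mem (F.pow_mem (F.pow_mem h Q) Q) Q
      · rw [← hQ4 x]
        exact hcosetQ _ (hcosetQ _ (hcosetQ _ h))
    · intro x hx h
      rw [Set.Finite.mem_toFinset] at hx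
      apply hx.2.1
      -- An orbit of length at most two would give `x ^ 2 ∈ U`. The odd power `x ^ F.index ∈ F` then
      -- lies in `xU`, so the only element of `D` in that coset, namely `x`, lies in `F`.
      have hx2 : x ^ 2 ∈ U := by
        have h1 : x ^ (Q ^ 2 + 1) ∈ U := hUidx ▸ U.pow_index_mem x
        rwa [pow_succ, h, ← sq] at h1
      obtain ⟨k, hk⟩ := hFodd
      have h1 : x ^ (2 * k + 1) ∈ F := hk ▸ F.pow_index_mem x
      have h2 : x⁻¹ * x ^ (2 * k + 1) ∈ U := by
        rw [pow_succ', inv_mul_cancel_left, pow_mul]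
        exact U.pow_mem hx2 k
      refine hF _ h1 (fun h3 => hx.2.2 ?_) x hx.1 ?_
      · have := U.mul_mem h3 (U.inv_mem h2)
        convert this using 1
        rw [mul_inv, inv_inv, mul_assoc, mul_comm x, mul_inv_cancel_left]
      · have := U.inv_mem h2
        rwa [mul_inv, inv_inv, mul_comm] at this
  -- Inversion pairs these elements off: as `F` has odd index, it contains every involution.
  have hUsdiff : ∏ᶠ u ∈ (U : Set G) \ F, u = 1 := by
    rw [finprod_mem_eq_finite_toFinset_prod _ (Set.toFinite _)]
    refine Finset.prod_involution (fun u _ => u⁻¹) (by simp) ?_ ?_ (by simp)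
    · intro u hu _ h
      rw [Set.Finite.mem_toFinset] at hu
      apply hu.2
      refine mem_of_sq_mem_of_odd hFodd (F.pow_index_mem u) ?_
      have h1 : u ^ 2 = 1 := by rw [sq, ← inv_eq_iff_mul_eq_one, h]
      exact h1 ▸ F.one_mem
    · intro u hu
      rw [Set.Finite.mem_toFinset] at hu ⊢
      simpa using hu
  have hncard : ((U : Set G) \ F).ncard = Q - q := by
    have h1 := Set.ncard_inter_add_ncard_sdiff_eq_ncard (U : Set G) (F : Set G) (Set.toFinite _)
    rw [ncard_inter_eq_card_subgroupOf, hUF] at h1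
    have h2 : (U : Set G).ncard = Q + 1 := hUcard
    omega
  have hcoset : ∏ᶠ x ∈ (fun u => c * u) '' ((U : Set G) \ F), x = 1 := by
    rw [finprod_mem_image (mul_right_injective c).injOn, finprod_mem_mul_left, hUsdiff, hncard,
      hcpow, one_mul]
  have hsdiff : D \ F = (fun u => c * u) '' ((U : Set G) \ F) ∪ S := by
    ext x
    rw [Set.image_mul_left]
    have h1 : c⁻¹ * x ∈ F ↔ x ∈ F := F.mul_mem_cancel_left (F.inv_mem hcF)
    have h2 : c⁻¹ * x ∈ U → x ∈ D := fun h => by simpa using hcU _ h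
    simp only [Set.mem_sdiff, SetLike.mem_coe, Set.mem_union, Set.mem_preimage, h1, hS,
      Set.mem_ofPred_eq]
    tauto
  have hdisj : Disjoint ((fun u => c * u) '' ((U : Set G) \ F)) S := by
    rw [Set.disjoint_left]
    rintro x ⟨u, hu, rfl⟩ hx
    exact hx.2.2 (by simpa using hu.1)
  have hprod := finprod_mem_inter_mul_sdiff (f := fun x : G => x) (F : Set G) (Set.toFinite D)
  rw [hsdiff, finprod_mem_union hdisj (Set.toFinite _) (Set.toFinite _), hcoset, hSprod, mul_one,
    mul_one, ← coe_image_preimage, finprod_mem_image Subtype.val_injective.injOn] at hprod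
  apply Subtype.val_injective
  have h1 := F.subtype.map_finprod_mem id (Set.toFinite ((fun x : F => (x : G)) ⁻¹' D))
  exact (h1.trans hprod).trans hnorm

end Intersection

/-! ### The main theorem -/

theorem theorem4p3 {G : Type*} [CommGroup G] [Finite G] (q s : ℕ) (hq : IsPrimePow q)
    (hs : s.Prime) (hs_odd : Odd s) (hqs : q ≤ s) (hsq : ¬ s ∣ q ^ 2 + 1)
    (hG : Nat.card G = (q ^ s + 1) * (q ^ (2 * s) + 1))
    (D : Set G) (hD : IsClassicalDifferenceSet (q ^ s) 4 D) (hD_norm : IsNormalizedSet D)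
    (M : Subgroup G) (hM : Nat.card M = (q + 1) * (q ^ 2 + 1)) :
    IsNormalizedSet ((fun x : M => (x : G)) ⁻¹' D) ∧
      IsClassicalDifferenceSet q 4 ((fun x : M => (x : G)) ⁻¹' D) ∧
      IsDifferenceSet ((q + 1) * (q ^ 2 + 1)) (q ^ 2 + q + 1) (q + 1)
        ((fun x : M => (x : G)) ⁻¹' D) := by
  obtain ⟨p, j, hp, hj, hpj⟩ := (isPrimePow_nat_iff q).1 hq
  have hq2 : 2 ≤ q := hq.two_le
  obtain ⟨r₁, hr₁, hr₁_odd, -⟩ := exists_pow_add_one_eq_mul (n := q) hs_odd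
  obtain ⟨r₂, hr₂, hr₂_odd, hr₂_mod⟩ := exists_pow_add_one_eq_mul (n := q ^ 2) hs_odd
  have hnot := not_sq_add_one_dvd_pow_add_one hq2 hs_odd
  have hdvd := two_mul_add_one_dvd_pow_sub (q := q) hs_odd
  have hcofactor := fun l hl hlr =>
    not_prime_dvd_cofactor (l := l) hs hsq hr₂ hr₂_odd hr₂_mod hl hlr
  obtain ⟨Q, hQ⟩ : ∃ Q, Q = q ^ s := ⟨_, rfl⟩
  have hQ2 : 2 ≤ Q := hQ ▸ hq2.trans (Nat.le_self_pow hs.ne_zero q)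
  have hpQ : p ^ (j * s) = Q := by rw [pow_mul, hpj, hQ]
  have he : 0 < j * s := Nat.mul_pos hj hs.pos
  have hDdiff := hD.isDifferenceSet
  rw [← hQ] at hDdiff
  norm_num only at hDdiff
  rw [pow_four_sub_one_div hQ2, pow_three_sub_one_div hQ2, pow_two_sub_one_div hQ2] at hDdiff
  have hGcard : Nat.card G = (Q + 1) * (Q ^ 2 + 1) := hDdiff.card_group
  have hG1 : ∀ x : G, x ^ ((Q + 1) * (Q ^ 2 + 1)) = 1 := fun x => by
    rw [← hGcard, pow_card_eq_one']
  have hG4 : ∀ x : G, x ^ Q ^ 4 = x := fun x => by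
    obtain ⟨n, rfl⟩ : ∃ n, Q = n + 1 := ⟨Q - 1, by omega⟩
    have h1 : (n + 1) ^ 4 = (n + 1 + 1) * ((n + 1) ^ 2 + 1) * n + 1 := by ring
    rw [h1, pow_succ, pow_mul, hG1, one_pow, one_mul]
  have hDp : ∀ x ∈ D, x ^ p ∈ D := by
    have hQsq : p ^ (2 * (j * s)) = Q ^ 2 := by rw [mul_comm, pow_mul, hpQ]
    refine fun x hx => hDdiff.pow_mem hD_norm hp (a := 2 * (j * s)) (m := 4 * (j * s)) ?_ ?_
      (by omega) (fun g => ?_) (fun g hg => ?_) hx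
    · rw [hQsq]; ring
    · rw [hQsq]; nlinarith
    · rw [mul_comm, pow_mul, hpQ, hG4]
    · have h1 : (Q + 1) * (Q ^ 2 + 1) = (Q ^ 2 + Q + 1) * Q + 1 := by ring
      have h2 := hG1 g
      rwa [h1, pow_succ, pow_mul, hg, one_pow, one_mul] at h2
  have hDq4 : ∀ x ∈ D, x ^ q ^ 4 ∈ D := by
    rw [← hpj, ← pow_mul]
    exact pow_mem_of_pow_mem hDp _
  have hDQ : ∀ x ∈ D, x ^ Q ∈ D := hpQ ▸ pow_mem_of_pow_mem hDp _
  have hDQ2 : (fun g => g ^ Q ^ 2) '' D = D := by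
    have h1 : ∀ x ∈ D, x ^ Q ^ 2 ∈ D := pow_mem_of_pow_mem hDQ 2
    apply Set.Subset.antisymm
    · rintro _ ⟨x, hx, rfl⟩
      exact h1 x hx
    · intro x hx
      refine ⟨_, h1 x hx, ?_⟩
      refine Eq.trans ?_ (hG4 x)
      change (x ^ Q ^ 2) ^ Q ^ 2 = x ^ Q ^ 4
      rw [← pow_mul, ← pow_add]
  obtain ⟨U, hU⟩ := exists_subgroup_card_eq (Q + 1) (A := G) (hGcard ▸ dvd_mul_right _ _)
  have hUidx : U.index = Q ^ 2 + 1 := by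
    have h1 := U.card_mul_index
    rw [hU, hGcard] at h1
    exact Nat.eq_of_mul_eq_mul_left (by omega) h1
  have hQr₂ : Q ^ 2 + 1 = (q ^ 2 + 1) * r₂ := by
    rw [hQ, ← pow_mul, mul_comm s 2, pow_mul, hr₂]
  have hMidx : Odd M.index := by
    have h1 := M.card_mul_index
    rw [hM, hGcard, hQr₂, hQ, hr₁] at h1
    have h2 : M.index = r₁ * r₂ := by
      apply Nat.eq_of_mul_eq_mul_left (show 0 < (q + 1) * (q ^ 2 + 1) by positivity)
      rw [h1]; ring
    exact h2 ▸ hr₁_odd.mul hr₂_odd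
  obtain ⟨c, hcM, hc2, hcU, hc⟩ : ∃ c ∈ M, c ^ 2 ∈ U ∧ (∀ u ∈ U, c * u ∈ D) ∧
      ∀ x, c⁻¹ * x ∉ U → ∃ d, {y ∈ D | x⁻¹ * y ∈ U} = {d} := by
    obtain ⟨b, hb2, hbU, hb⟩ := IsDifferenceSet.exists_coset_subset (p := p) (e := j * s)
      (hpQ.symm ▸ hDdiff) hp he (by rw [hpQ]) (hpQ.symm ▸ hDQ2) U (hpQ.symm ▸ hU)
    obtain ⟨k, hk⟩ := hMidx
    have hbk : (b ^ 2) ^ k ∈ U := U.pow_mem hb2 k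
    have hpow : b ^ M.index = b * (b ^ 2) ^ k := by rw [hk, pow_succ', pow_mul]
    -- Since `M.index` is odd and `b ^ 2 ∈ U`, this power represents the same coset `bU` and lies in
    -- `M`.
    refine ⟨b ^ M.index, M.pow_index_mem b, ?_, fun u hu => ?_, fun x hx => hb x fun h => hx ?_⟩
    · rw [← pow_mul, mul_comm, pow_mul]
      exact U.pow_mem hb2 _
    · rw [hpow, mul_assoc]
      exact hbU _ (U.mul_mem hbk hu)
    · rw [hpow, mul_inv_rev, mul_assoc]
      exact U.mul_mem (U.inv_mem hbk) h
  obtain ⟨F, hF⟩ : ∃ F : Subgroup G, ∀ x, x ∈ F ↔ x ^ q ^ 4 = x := by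
    refine ⟨(powMonoidHom (q ^ 4 - 1)).ker, fun x => ?_⟩
    have h1 : 1 ≤ q ^ 4 := Nat.one_le_pow _ _ (by omega)
    rw [MonoidHom.mem_ker, powMonoidHom_apply]
    conv_rhs => rw [← Nat.sub_add_cancel h1, pow_succ, mul_eq_right]
  have hMF : M ≤ F := by
    intro x hx
    rw [hF]
    obtain ⟨n, rfl⟩ : ∃ n, q = n + 1 := ⟨q - 1, by omega⟩
    have h1 : (n + 1) ^ 4 = (n + 1 + 1) * ((n + 1) ^ 2 + 1) * n + 1 := by ring
    have h2 : x ^ Nat.card M = 1 := congrArg Subtype.val (pow_card_eq_one' (x := (⟨x, hx⟩ : M)))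
    rw [h1, ← hM, pow_succ, pow_mul, h2, one_pow, one_mul]
  have hidx_dvd : (U.subgroupOf F).index ∣ q ^ 2 + 1 := by
    have h1 : 1 ≤ q ^ 4 := Nat.one_le_pow _ _ (by omega)
    refine index_subgroupOf_dvd (n := q ^ 4 - 1) (fun x hx => ?_) (hUidx.trans hQr₂)
      (fun l hl hlr h => hcofactor l hl hlr ?_)
    · have h2 := (hF x).1 hx
      rwa [← Nat.sub_add_cancel h1, pow_succ, mul_eq_right] at h2
    · have h2 : ((q ^ 4 - 1 : ℕ) : ℤ) = ((q ^ 2 : ℕ) : ℤ) ^ 2 - 1 := by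
        push_cast [h1]; ring
      rw [← h2]
      exact_mod_cast h
  have hidx : (U.subgroupOf F).index ≠ 1 := by
    intro h
    rw [Subgroup.index_eq_one, Subgroup.subgroupOf_eq_top] at h
    have h1 := Subgroup.card_dvd_of_le (hMF.trans h)
    rw [hM, hU, hQ] at h1
    exact hnot ((dvd_mul_left _ _).trans h1)
  have hDcount : ∀ g : G, g ≠ 1 → {b ∈ D | g * b ∈ D}.ncard = q ^ s + 1 :=
    hQ ▸ (isDifferenceSet_iff.1 hDdiff).2.2.2
  obtain ⟨hdiff, hUF⟩ := isDifferenceSet_inter_fixed hq2 hs hqs hDcount hF hDq4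
    (fun x => by rw [← pow_mul, mul_comm, pow_mul, ← hQ, hG4]) (hMF hcM) hcU hc hidx
    (Nat.le_of_dvd (by positivity) hidx_dvd) (hM ▸ Subgroup.card_le_of_le hMF)
  obtain rfl : M = F := Subgroup.eq_of_le_of_card_ge hMF (by rw [hM, hdiff.card_group])
  refine ⟨?_, ⟨hq, by norm_num, ?_⟩, hdiff⟩
  · refine isNormalizedSet_inter (by omega) hD_norm hG4 hG1 hDQ hcM hc2 hcU hUidx hU hMidx
      (fun x hx hxU d hd hxd => mem_of_unique_in_coset hF hDq4 hc hx hxU hd hxd) hUF ?_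
    obtain ⟨k, hk⟩ := hdvd
    -- `c ^ 2` lies in `U ∩ M`, of order `q + 1`, and `2 * (q + 1)` divides `Q - q`.
    let y : U.subgroupOf M := ⟨⟨c ^ 2, M.pow_mem hcM 2⟩, hc2⟩
    have h1 : (c ^ 2) ^ (q + 1) = 1 :=
      congrArg (fun z : U.subgroupOf M => ((z : M) : G)) (hUF ▸ pow_card_eq_one' (x := y))
    rw [hQ, hk, pow_mul, pow_mul, h1, one_pow]
  · norm_num only
    rw [pow_four_sub_one_div hq2, pow_three_sub_one_div hq2, pow_two_sub_one_div hq2]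
    exact hdiff
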